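/- **Setting.** For an extended-real-valued $\varphi$ write $\operatorname{dom}\varphi=\{\varphi<\infty\}$. Let $f:\mathbb{R}^n\to\mathbb{R}\cup\{+\infty\}$ be proper, closed and convex; let $h:\mathbb{R}^n\to\mathbb{R}$ be continuously differentiable with $\|\nabla h(x)-\nabla h(y)\|\le L_h\|x-y\|$ for all $x,y$, where $L_h>0$; let $g:\mathbb{R}^n\to\mathbb{R}$ be continuous and convex. Put $\Omega=\{x: g(x)\ne 0\}$ and assume that $g>0$ on $\operatorname{dom} f\cap\Omega$, that $f+h\ge 0$ on $\operatorname{dom} f$, and that $f(x)+h(x)>0$ whenever $g(x)=0$. Let $F(x)=\frac{f(x)+h(x)}{g(x)}$ for $x\in\operatorname{dom} f\cap\Omega$ and $F(x)=+\infty$ otherwise, and assume that every sublevel set $\{F\le\alpha\}$, $\alpha\in\mathbb{R}$, is bounded. Assume also that $f$ is locally Lipschitz continuous on $\operatorname{dom} f$ and that $g$ is continuously differentiable on $\Omega$ with locally Lipschitz gradient. For $\delta\ge0$ and $z\in\operatorname{dom}\varphi$ let $\partial_\delta \varphi(z)=\{d:\varphi(w)\ge \varphi(z)+\langle d,w-z\rangle-\delta\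 \ \forall w\}$ denote the $\delta$-subdifferential of a convex function $\varphi$, with $\partial \varphi=\partial_0 \varphi$. **Algorithm.** Let $\varepsilon_k\ge 0$, and let $H_k$ be symmetric positive definite matrices such that $\underline\gamma I\preceq H_k\preceq\overline\gamma I$ for all $k\ge0$, for some constants with $\frac{L_h}{2}<\underline\gamma\le\overline\gamma$. Let $\{x^k\}_{k\ge0}\subset\Omega\cap\operatorname{dom} f$ be an infinite sequence such that for every $k\ge 0$, with $c_k=\frac{f(x^k)+h(x^k)}{g(x^k)}$, there are $y^k\in\partial g(x^k)$, $\Delta^k\in\mathbb{R}^n$ and $\delta_k\ge0$ with $$\Delta^k\in\partial_{\delta_k}f(x^{k+1})+\nabla h(x^k)-c_ky^k+H_k(x^{k+1}-x^k),$$ $$\|\Delta^k\|^2+|\langle\Delta^k,x^{k+1}-x^k\rangle|+\delta_k\le\varepsilon_k\,g(x^{k+1}),$$ and such that $\delta_k=0$ for all sufficiently large $k$. **KL exponent.** Let $\partial$ now also denote the limiting subdifferential of a proper closed function (it agrees with the one above for convex functions). A proper closed function $\varphi$ is a KL function with exponent $\theta\in[0,1)$ if for every $\tilde z$ with $\partial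 \varphi(\tilde z)\ne\emptyset$ there are $a,\mu,\nu>0$ such that $\operatorname{dist}(0,\partial \varphi(z))\ge a(\varphi(z)-\varphi(\tilde z))^\theta$ for all $z$ with $\partial \varphi(z)\neq\emptyset$, $\|z-\tilde z\|\le\mu$ and $\varphi(\tilde z)<\varphi(z)<\varphi(\tilde z)+\nu$. **Theorem.** Let $\tau>1$, and suppose that $\sum_{k\ge 0}\varepsilon_k<\infty$, $\sum_{k\ge 0}\sqrt{\varepsilon_k}<\infty$ and $\sum_{k\ge0}\big(\sum_{i\ge k}\varepsilon_i\big)^{1-1/\tau}<\infty$. Suppose that $\Phi_\tau(x,t)=F(x)+\frac{t^\tau}{\tau}$ for $t\ge0$ (and $\Phi_\tau(x,t)=+\infty$ for $t<0$) is a KL function on $\mathbb{R}^n\times\mathbb{R}$ with exponent $\theta_\tau\in[0,1)$. Then $\{x^k\}$ converges; let $x^*$ be its limit. The following hold, all $\mathcal{O}$ being as $k\to\infty$. (i) If $\theta_\tau=0$, then $x^k=x^*$ for all sufficiently large $k$. (ii) Let $\theta_\tau\in(0,\frac12]$. - (a) If $\varepsilon_k=\varepsilon_0q^k$ with $\varepsilon_0>0$,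 $0<q<1$, then $\|x^k-x^*\|=\mathcal{O}(\varrho^k)$ for some $\varrho\in(0,1)$. - (b) If $\varepsilon_k=\frac{\varepsilon_0}{(k+1)^q}$ with $\varepsilon_0>0$, $q>\frac{2\tau-1}{\tau-1}$, then $$\|x^k-x^*\|=\begin{cases}\mathcal{O}\big(k^{-[\frac{\tau-1}{\tau}(q-1)-1]}\big)&\text{if }1<\tau\le2,\\ \mathcal{O}\big(k^{-[\frac{\tau-1}{\tau}(q-1)-1]}\big)&\text{if }\tau>2\text{ and }q<\frac{2(\tau-1)}{\tau-2},\\ \mathcal{O}\big(k^{-(\frac q2-1)}\big)&\text{if }\tau>2\text{ and }q\ge\frac{2(\tau-1)}{\tau-2}.\end{cases}$$ (iii) Let $\theta_\tau\in(\frac12,1)$. - (a) If $\varepsilon_k=\varepsilon_0q^k$ with $\varepsilon_0>0$, $0<q<1$, then $\|x^k-x^*\|=\mathcal{O}\big(k^{-\frac{1-\theta_\tau}{2\theta_\tau-1}}\big)$. - (b) Let $\varepsilon_k=\frac{\varepsilon_0}{(k+1)^q}$ with $\varepsilon_0>0$, $q>\frac{2\tau-1}{\tau-1}$. - (b1) If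 $1<\tau\le2$, or if $\tau>2$ and $q<\frac{2(\tau-1)}{\tau-2}$, then $$\|x^k-x^*\|=\begin{cases}\mathcal{O}\big(k^{-[\frac{\tau-1}{\tau}(q-1)-1]}\big)&\text{if }q<\frac{\tau}{\tau-1}\cdot\frac{\theta_\tau}{2\theta_\tau-1}+1,\\ \mathcal{O}\big(k^{-\frac{1-\theta_\tau}{2\theta_\tau-1}}\big)&\text{otherwise.}\end{cases}$$ - (b2) If $\tau>2$ and $q\ge\frac{2(\tau-1)}{\tau-2}$, then $$\|x^k-x^*\|=\begin{cases}\mathcal{O}\big(k^{-(\frac q2-1)}\big)&\text{if }q<\frac{2\theta_\tau}{2\theta_\tau-1},\\ \mathcal{O}\big(k^{-\frac{1-\theta_\tau}{2\theta_\tau-1}}\big)&\text{otherwise.}\end{cases}$$ -/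

import Mathlib

open Filter Topology Asymptotics

/-- Real Euclidean `n`-space with its Euclidean norm and inner product. -/
abbrev RSpace (n : ℕ) : Type := EuclideanSpace ℝ (Fin n)

section GeneralNotions

variable {V : Type*} [NormedAddCommGroup V] [InnerProductSpace ℝ V]

/-- The effective domain of an extended-real-valued function. -/
def effDom (φ : V → EReal) : Set V := {x | φ x ≠ ⊤}

/-- Proper: never `-∞`, and finite somewhere. -/
def IsProperFun (φ : V → EReal) : Prop := (∀ x, φ x ≠ ⊥) ∧ (effDom φ).Nonempty

/-- Convexity of an extended-real-valued function: its epigraph is convex. -/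
def IsConvexFun (φ : V → EReal) : Prop :=
  Convex ℝ {p : V × ℝ | φ p.1 ≤ (p.2 : EReal)}

/-- Level-boundedness: all (real) sublevel sets are bounded. -/
def IsLevelBounded (φ : V → EReal) : Prop :=
  ∀ α : ℝ, Bornology.IsBounded {x | φ x ≤ (α : EReal)}

/-- The regular (Fréchet) subdifferential. For `φ x` finite, the inequality
`liminf_{y → x, y ≠ x} (φ y - φ x - ⟪d, y - x⟫) / ‖y - x‖ ≥ 0` is written out as: for every
`η > 0`, `φ y ≥ φ x + ⟪d, y - x⟫ - η ‖y - x‖` for all `y` near `x`. -/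
def regSubdiff (φ : V → EReal) (x : V) : Set V :=
  {d | φ x ≠ ⊤ ∧ φ x ≠ ⊥ ∧ ∀ η : ℝ, 0 < η → ∀ᶠ y in 𝓝 x,
    (((φ x).toReal + inner ℝ d (y - x) - η * ‖y - x‖ : ℝ) : EReal) ≤ φ y}

/-- The limiting subdifferential. -/
def limSubdiff (φ : V → EReal) (x : V) : Set V :=
  {d | φ x ≠ ⊤ ∧ φ x ≠ ⊥ ∧ ∃ (u v : ℕ → V),
    Tendsto u atTop (𝓝 x) ∧ Tendsto (fun k => φ (u k)) atTop (𝓝 (φ x)) ∧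
    (∀ k, v k ∈ regSubdiff φ (u k)) ∧ Tendsto v atTop (𝓝 d)}

/-- The `δ`-subdifferential of a proper convex function; `δ = 0` is the convex subdifferential. -/
def epsSubdiff (δ : ℝ) (φ : V → EReal) (x : V) : Set V :=
  {d | φ x ≠ ⊤ ∧ ∀ y, (((φ x).toReal + inner ℝ d (y - x) - δ : ℝ) : EReal) ≤ φ y}

/-- The KL property at `x₀` with exponent `θ`. -/
def HasKLExponentAt (φ : V → EReal) (θ : ℝ) (x₀ : V) : Prop :=
  ∃ a > (0 : ℝ), ∃ μ > (0 : ℝ), ∃ ν > (0 : ℝ), ∀ x : V,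
    (limSubdiff φ x).Nonempty → ‖x - x₀‖ ≤ μ → φ x₀ < φ x → φ x < φ x₀ + (ν : EReal) →
      a * ((φ x).toReal - (φ x₀).toReal) ^ θ ≤ Metric.infDist 0 (limSubdiff φ x)

/-- `φ` is a KL function with exponent `θ`: it has the KL property with exponent `θ` at every
point of the domain of its limiting subdifferential. -/
def IsKLFunctionWithExponent (φ : V → EReal) (θ : ℝ) : Prop :=
  ∀ x₀ : V, (limSubdiff φ x₀).Nonempty → HasKLExponentAt φ θ x₀

end GeneralNotions

noncomputable section

variable {n : ℕ}

open Classical in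
/-- The fractional objective `F = (f + h) / g` on `dom f ∩ Ω`, and `+∞` elsewhere, where
`Ω = {g ≠ 0}`. -/
def fracObj (f : RSpace n → EReal) (h g : RSpace n → ℝ) (x : RSpace n) : EReal :=
  if f x ≠ ⊤ ∧ g x ≠ 0 then ((((f x).toReal + h x) / g x : ℝ) : EReal) else ⊤

open Classical in
/-- The auxiliary function `Φ_τ (x, t) = F x + t ^ τ / τ` for `t ≥ 0`, and `+∞` for `t < 0`,
on `ℝⁿ × ℝ` with the Euclidean norm. -/
def auxFun (τ : ℝ) (f : RSpace n → EReal) (h g : RSpace n → ℝ)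
    (p : WithLp 2 (RSpace n × ℝ)) : EReal :=
  if 0 ≤ p.snd then fracObj f h g p.fst + ((p.snd ^ τ / τ : ℝ) : EReal) else ⊤

/-- The basic assumptions on `f`, `h`, `g`, with `L` a Lipschitz constant of `∇h`. -/
structure BasicAssumptions (f : RSpace n → EReal) (h g : RSpace n → ℝ) (L : ℝ) : Prop where
  f_proper : IsProperFun f
  f_closed : LowerSemicontinuous f
  f_convex : IsConvexFun f
  h_contDiff : ContDiff ℝ 1 h
  L_pos : 0 < L
  h_lipschitz : ∀ x y, ‖gradient h x - gradient h y‖ ≤ L * ‖x - y‖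
  g_continuous : Continuous g
  g_convex : ConvexOn ℝ Set.univ g
  g_pos : ∀ x, f x ≠ ⊤ → g x ≠ 0 → 0 < g x
  sum_nonneg : ∀ x, f x ≠ ⊤ → 0 ≤ (f x).toReal + h x
  sum_pos : ∀ x, f x ≠ ⊤ → g x = 0 → 0 < (f x).toReal + h x
  levelBounded : IsLevelBounded (fracObj f h g)

/-- The value `c_k = (f (x k) + h (x k)) / g (x k)` computed by the algorithm. -/
def ratioAt (f : RSpace n → EReal) (h g : RSpace n → ℝ) (z : RSpace n) : ℝ :=
  ((f z).toReal + h z) / g z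

/-- `x` is an (infinite) sequence generated by the inexact variable metric proximal
gradient-subgradient algorithm, with tolerances `ε`, metrics `H`, chosen subgradients `y` and
error pairs `(Δ k, δ k)`. -/
structure IsIVPGSA (f : RSpace n → EReal) (h g : RSpace n → ℝ)
    (ε : ℕ → ℝ) (H : ℕ → Matrix (Fin n) (Fin n) ℝ)
    (x y Δ : ℕ → RSpace n) (δ : ℕ → ℝ) : Prop where
  eps_nonneg : ∀ k, 0 ≤ ε k
  metric_posDef : ∀ k, (H k).PosDef
  delta_nonneg : ∀ k, 0 ≤ δ k
  mem_domain : ∀ k, f (x k) ≠ ⊤ ∧ g (x k) ≠ 0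
  subgrad : ∀ k, y k ∈ epsSubdiff 0 (fun z => (g z : EReal)) (x k)
  /- `Δ k ∈ ∂_{δ k} f (x (k+1)) + ∇h (x k) - c_k y k + H k (x (k+1) - x k)` -/
  inexact : ∀ k, ∃ d ∈ epsSubdiff (δ k) f (x (k + 1)),
    Δ k = d + gradient h (x k) - ratioAt f h g (x k) • y k
      + (H k).toEuclideanLin (x (k + 1) - x k)
  criterion : ∀ k,
    ‖Δ k‖ ^ 2 + |inner ℝ (Δ k) (x (k + 1) - x k)| + δ k ≤ ε k * g (x (k + 1))

end

/-!
Write `c k` for the ratio at `x k`, `R k` for the tail `∑_{i ≥ k} ε i`, and `s k` for the step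
`x (k + 1) - x k`. The inexact optimality condition, the quadratic upper bound for `h` and the
convexity of `f` and `g` give the sufficient decrease `c (k + 1) + b ‖s k‖² ≤ c k + ε k`
(`IsIVPGSA.ratioAt_succ_le`). So `c k + R k` decreases, the iterates stay in a compact part of
`dom f ∩ {g ≠ 0}` (`BasicAssumptions.isCompact_closure_range`), and there `f`, `g`, `∇g` and the
ratio are Lipschitz. Choosing `t k` with `t k ^ τ / τ = R k` makes the auxiliary function equal to
`c k + R k` at `(x k, t k)`. Once `δ k = 0`, the optimality condition and the quotient rule give a
subgradient there of norm `O (‖s k‖ + e k)`, where `e k = √(ε k) + R k ^ (1 - 1 / τ)`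
(`IsIVPGSA.exists_regSubdiff_norm_le`).

With `φ k = c k + R k - lim c`, the KL inequality becomes `φ (k + 1) ^ θ ≤ C (‖s k‖ + e k)` near a
cluster point. Concavity of `u ↦ u ^ (1 - θ)` turns this and the decrease into
`‖s (k + 1)‖ ≤ (‖s k‖ + e k) / 2 + c (φ (k + 1) ^ (1 - θ) - φ (k + 2) ^ (1 - θ))`, which says that
`W k = 2 ‖s k‖ + 2 c φ (k + 1) ^ (1 - θ) + ∑_{i ≥ k} e i` drops by at least `‖s k‖` at each step.
Hence `x` converges and `‖x k - x*‖ ≤ W k` (`tendsto_of_kl`).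

Bounding `φ (k + 1) ^ (1 - θ)` by the KL inequality gives, with `α = (1 - θ) / θ`, the recursion
`W k ≤ C (W k - W (k + 1) + e k) ^ α + C (W k - W (k + 1)) + ∑_{i ≥ k} e i`. For `α ≥ 1` it is a
perturbed linear contraction, and `W` decays like the tail of `e`, or geometrically. For `α < 1`
it gives `W k = O (k ^ (-p))` as soon as `e k = O (k ^ (-p - 1))` and `p ≤ α / (1 - α)`
(`KLRecursion.isBigO_rpow_of_lt_one`). The stated exponents are `p = min (q / 2)
((τ - 1) / τ * (q - 1)) - 1`, capped by `α / (1 - α) = (1 - θ) / (2 * θ - 1)` when `θ > 1 / 2`.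
If `φ` vanishes at some index, the iterates are constant from there on. For `θ = 0` this is the
only possibility, since the KL inequality would read `1 ≤ C (‖s k‖ + e k) → 0`.
-/

/-! ### Power sequences and tails of series -/

/-- Bernoulli's inequality for nonpositive exponents. -/
lemma one_sub_mul_le_one_add_rpow_neg {s x : ℝ} (hs : 0 ≤ s) (hx : -1 < x) :
    1 - s * x ≤ (1 + x) ^ (-s) := by
  have h1 : 0 < 1 + x := by linarith
  rw [Real.rpow_def_of_pos h1]
  have h2 := Real.log_le_sub_one_of_pos h1
  have h3 := Real.add_one_le_exp (Real.log (1 + x) * -s)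
  nlinarith

lemma rpow_neg_sub_rpow_neg_succ_le {p : ℝ} (hp : 0 ≤ p) {k : ℕ} (hk : 1 ≤ k) :
    (k : ℝ) ^ (-p) - ((k + 1 : ℕ) : ℝ) ^ (-p) ≤ p * (k : ℝ) ^ (-(p + 1)) := by
  have hk0 : (0 : ℝ) < k := by exact_mod_cast hk
  have h := one_sub_mul_le_one_add_rpow_neg hp (x := 1 / (k : ℝ))
    (by have : 0 < 1 / (k : ℝ) := by positivity
        linarith)
  have e1 : ((k + 1 : ℕ) : ℝ) = k * (1 + 1 / (k : ℝ)) := by push_cast; field_simp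
  rw [e1, Real.mul_rpow hk0.le (by positivity), neg_add, Real.rpow_add hk0, Real.rpow_neg_one]
  have h5 : 0 < (k : ℝ) ^ (-p) := by positivity
  have := mul_le_mul_of_nonneg_left h h5.le
  have e2 : p * ((k : ℝ) ^ (-p) * (k : ℝ)⁻¹) = (k : ℝ) ^ (-p) * (p * (1 / (k : ℝ))) := by
    rw [one_div]; ring
  rw [e2]; linarith

lemma rpow_neg_le_two_rpow_mul_succ {p : ℝ} (hp : 0 ≤ p) {k : ℕ} (hk : 1 ≤ k) :
    (k : ℝ) ^ (-p) ≤ 2 ^ p * ((k + 1 : ℕ) : ℝ) ^ (-p) := by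
  have hk0 : (0 : ℝ) < k := by exact_mod_cast hk
  have hk1 : (1 : ℝ) ≤ k := by exact_mod_cast hk
  have h : (2 * (k : ℝ)) ^ (-p) ≤ ((k + 1 : ℕ) : ℝ) ^ (-p) :=
    Real.rpow_le_rpow_of_nonpos (by positivity) (by push_cast; linarith) (by linarith)
  rw [Real.mul_rpow (by norm_num) hk0.le, Real.rpow_neg (by norm_num)] at h
  have h2 : (0 : ℝ) < 2 ^ p := by positivity
  calc (k : ℝ) ^ (-p) = 2 ^ p * ((2 ^ p)⁻¹ * (k : ℝ) ^ (-p)) := by field_simp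
    _ ≤ _ := by gcongr

lemma rpow_neg_succ_le_sub {p : ℝ} (hp : 0 < p) {k : ℕ} (hk : 1 ≤ k) :
    ((k + 1 : ℕ) : ℝ) ^ (-(p + 1)) ≤
      (1 / p) * ((k : ℝ) ^ (-p) - ((k + 1 : ℕ) : ℝ) ^ (-p)) := by
  have hk0 : (0 : ℝ) < k := by exact_mod_cast hk
  set m : ℝ := ((k + 1 : ℕ) : ℝ) with hm
  have hmk : m = k + 1 := by rw [hm]; push_cast; ring
  have hm0 : 0 < m := by rw [hmk]; linarith
  have h := one_sub_mul_le_one_add_rpow_neg hp.le (x := -(1 / m))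
    (by rw [neg_lt_neg_iff, div_lt_one hm0]; linarith)
  have e1 : (k : ℝ) = m * (1 + -(1 / m)) := by rw [mul_add, mul_neg, mul_one_div_cancel hm0.ne']; linarith
  have h1 : (0 : ℝ) ≤ 1 + -(1 / m) := by
    have : 1 / m ≤ 1 := by rw [div_le_one hm0]; linarith
    linarith
  rw [e1, Real.mul_rpow hm0.le h1, neg_add, Real.rpow_add hm0, Real.rpow_neg_one]
  have h5 : 0 < m ^ (-p) := by positivity
  have := mul_le_mul_of_nonneg_left h h5.le
  rw [one_div, ← div_eq_inv_mul, le_div_iff₀ hp]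
  have e2 : m ^ (-p) * m⁻¹ * p = m ^ (-p) * (p * (1 / m)) := by rw [one_div]; ring
  rw [e2]; linarith

/-- The tail `∑_{i ≥ k} e i` of a series. -/
noncomputable def tailSum (e : ℕ → ℝ) (k : ℕ) : ℝ := ∑' i, e (k + i)

lemma tailSum_nonneg {e : ℕ → ℝ} (he : ∀ k, 0 ≤ e k) (k : ℕ) : 0 ≤ tailSum e k :=
  tsum_nonneg fun _ => he _

lemma tailSum_eq_add {e : ℕ → ℝ} (hs : Summable e) (k : ℕ) :
    tailSum e k = e k + tailSum e (k + 1) := by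
  have h : Summable fun i => e (k + i) := by
    simpa only [add_comm] using (summable_nat_add_iff k).2 hs
  rw [tailSum, h.tsum_eq_zero_add, tailSum]
  simp only [add_zero, add_assoc, add_comm 1]

lemma tendsto_tailSum (e : ℕ → ℝ) : Tendsto (tailSum e) atTop (𝓝 0) := by
  refine (tendsto_sum_nat_add e).congr fun k => ?_
  simp only [tailSum, add_comm]

lemma tailSum_antitone {e : ℕ → ℝ} (he : ∀ k, 0 ≤ e k) (hs : Summable e) :
    Antitone (tailSum e) :=
  antitone_nat_of_succ_le fun k => by have := tailSum_eq_add hs k; linarith [he k]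

lemma tailSum_le_of_le_sub {e b : ℕ → ℝ} (he : ∀ k, 0 ≤ e k) (hb : ∀ k, 0 ≤ b k) (k : ℕ)
    (h : ∀ i ≥ k, e i ≤ b i - b (i + 1)) : tailSum e k ≤ b k := by
  refine Real.tsum_le_of_sum_range_le (fun _ => he _) fun n => ?_
  have : ∀ n, ∑ i ∈ Finset.range n, e (k + i) ≤ b k - b (k + n) := by
    intro n
    induction n with
    | zero => simp
    | succ n ih =>
      rw [Finset.sum_range_succ]
      have := h (k + n) (by omega)
      rw [← add_assoc]; linarith
  linarith [this n, hb (k + n)]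

lemma tailSum_le_of_le_rpow {e : ℕ → ℝ} (he : ∀ k, 0 ≤ e k) {p C : ℝ} (hp : 0 < p)
    (hC : 0 ≤ C) (h : ∀ k : ℕ, 1 ≤ k → e k ≤ C * (k : ℝ) ^ (-(p + 1))) {k : ℕ} (hk : 1 ≤ k) :
    tailSum e k ≤ C * 2 ^ (p + 1) / p * (k : ℝ) ^ (-p) := by
  refine tailSum_le_of_le_sub (b := fun k : ℕ => C * 2 ^ (p + 1) / p * (k : ℝ) ^ (-p)) he
    (fun _ => by positivity) k fun i hi => ?_
  have hi1 : 1 ≤ i := hk.trans hi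
  have h1 := rpow_neg_succ_le_sub hp hi1
  have h2 := rpow_neg_le_two_rpow_mul_succ (p := p + 1) (by linarith) hi1
  calc e i ≤ C * (i : ℝ) ^ (-(p + 1)) := h i hi1
    _ ≤ C * (2 ^ (p + 1) * ((1 / p) * ((i : ℝ) ^ (-p) - ((i + 1 : ℕ) : ℝ) ^ (-p)))) := by
        gcongr
        exact h2.trans (by gcongr)
    _ = _ := by ring

lemma tailSum_le_of_le_geometric {e : ℕ → ℝ} (he : ∀ k, 0 ≤ e k) {r C : ℝ} (hr : 0 ≤ r)
    (hr1 : r < 1) (hC : 0 ≤ C) (h : ∀ k, e k ≤ C * r ^ k) (k : ℕ) :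
    tailSum e k ≤ C / (1 - r) * r ^ k := by
  have h1 : 0 < 1 - r := by linarith
  refine tailSum_le_of_le_sub (b := fun k : ℕ => C / (1 - r) * r ^ k) he
    (fun _ => by positivity) k fun i _ => (h i).trans (le_of_eq ?_)
  field_simp
  ring

/-! ### Decay of sequences obeying a Kurdyka–Łojasiewicz type recursion -/

lemma isBigO_geometric_of_le {W : ℕ → ℝ} {ρ r C : ℝ} (hW : ∀ k, 0 ≤ W k) (hρ : 0 ≤ ρ)
    (hρ1 : ρ < 1) (hr1 : r < 1) (hr : 0 ≤ r) (hC : 0 ≤ C)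
    (h : ∀ᶠ k in atTop, W (k + 1) ≤ ρ * W k + C * r ^ k) :
    ∃ σ : ℝ, 0 < σ ∧ σ < 1 ∧ W =O[atTop] fun k : ℕ => σ ^ k := by
  obtain ⟨N, hN⟩ := eventually_atTop.1 h
  set m := max ρ r
  have hm1 : m < 1 := max_lt hρ1 hr1
  have hm0 : 0 ≤ m := le_max_of_le_left hρ
  set σ := (1 + m) / 2 with hσ
  have hσ0 : 0 < σ := by positivity
  have hρσ : ρ < σ := by have : ρ ≤ m := le_max_left _ _
                         linarith
  have hrσ : r ≤ σ := by have : r ≤ m := le_max_right _ _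
                         linarith
  refine ⟨σ, hσ0, by linarith, ?_⟩
  set M := max (W N / σ ^ N) (C / (σ - ρ))
  have hM2 : C ≤ M * (σ - ρ) := by
    rw [← div_le_iff₀ (by linarith)]; exact le_max_right _ _
  have key : ∀ k ≥ N, W k ≤ M * σ ^ k := by
    intro k hk
    induction k, hk using Nat.le_induction with
    | base => rw [← div_le_iff₀ (by positivity)]; exact le_max_left _ _
    | succ k hk ih =>
      have h1 : r ^ k ≤ σ ^ k := pow_le_pow_left₀ hr hrσ k
      have h2 : 0 < σ ^ k := by positivity
      calc W (k + 1) ≤ ρ * W k + C * r ^ k := hN k hk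
        _ ≤ ρ * (M * σ ^ k) + (M * (σ - ρ)) * σ ^ k := by gcongr
        _ = M * σ ^ (k + 1) := by ring
  refine IsBigO.of_bound M (eventually_atTop.2 ⟨N, fun k hk => ?_⟩)
  rw [Real.norm_of_nonneg (hW k), Real.norm_of_nonneg (by positivity)]
  exact key k hk

lemma isBigO_rpow_of_le {W : ℕ → ℝ} {ρ p C : ℝ} (hW : ∀ k, 0 ≤ W k) (hρ : 0 ≤ ρ)
    (hρ1 : ρ < 1) (hp : 0 ≤ p) (hC : 0 ≤ C)
    (h : ∀ᶠ k in atTop, W (k + 1) ≤ ρ * W k + C * (k : ℝ) ^ (-p)) :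
    W =O[atTop] fun k : ℕ => (k : ℝ) ^ (-p) := by
  have hlarge : ∀ᶠ k : ℕ in atTop, 2 * p / (1 - ρ) ≤ (k : ℝ) :=
    tendsto_natCast_atTop_atTop.eventually_ge_atTop _
  obtain ⟨N, hN⟩ := eventually_atTop.1 ((h.and hlarge).and (eventually_ge_atTop 1))
  set M := max (W N / (N : ℝ) ^ (-p)) (2 * C / (1 - ρ))
  have hρ' : 0 < 1 - ρ := by linarith
  have hM0 : 0 ≤ M := le_max_of_le_right (by positivity)
  have hM2 : 2 * C ≤ M * (1 - ρ) := by
    rw [← div_le_iff₀ hρ']; exact le_max_right _ _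
  have key : ∀ k ≥ N, W k ≤ M * (k : ℝ) ^ (-p) := by
    intro k hk
    induction k, hk using Nat.le_induction with
    | base =>
      have : (0 : ℝ) < N := by exact_mod_cast (hN N le_rfl).2
      rw [← div_le_iff₀ (by positivity)]; exact le_max_left _ _
    | succ k hk ih =>
      obtain ⟨⟨hk1, hk2⟩, hk3⟩ := hN k hk
      have hk0 : (0 : ℝ) < k := by exact_mod_cast hk3
      have h2 : 0 < (k : ℝ) ^ (-p) := by positivity
      have h4 := rpow_neg_sub_rpow_neg_succ_le hp hk3
      rw [neg_add, Real.rpow_add hk0, Real.rpow_neg_one] at h4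
      have h5 : p * (k : ℝ)⁻¹ ≤ (1 - ρ) / 2 := by
        rw [← div_eq_mul_inv, div_le_iff₀ hk0]
        rw [div_le_iff₀ hρ'] at hk2
        linarith
      have h6 : (1 + ρ) / 2 * (k : ℝ) ^ (-p) ≤ ((k + 1 : ℕ) : ℝ) ^ (-p) := by nlinarith
      calc W (k + 1) ≤ ρ * W k + C * (k : ℝ) ^ (-p) := hk1
        _ ≤ ρ * (M * (k : ℝ) ^ (-p)) + (M * (1 - ρ) / 2) * (k : ℝ) ^ (-p) := by
            gcongr; linarith
        _ = M * ((1 + ρ) / 2 * (k : ℝ) ^ (-p)) := by ring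
        _ ≤ M * ((k + 1 : ℕ) : ℝ) ^ (-p) := by gcongr
  refine IsBigO.of_bound M (eventually_atTop.2 ⟨N, fun k hk => ?_⟩)
  rw [Real.norm_of_nonneg (hW k), Real.norm_of_nonneg (by positivity)]
  exact key k hk

/-- The recursion satisfied by a majorant `W` of the distance to the limit: with the increment
`W k - W (k + 1)` bounding the step length, the Kurdyka–Łojasiewicz inequality bounds `W k` by
the power `α = (1 - θ) / θ` of the step length, up to the errors `e`. -/
def KLRecursion (W e : ℕ → ℝ) (α C : ℝ) : Prop :=
  ∀ᶠ k in atTop, W (k + 1) ≤ W k ∧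
    W k ≤ C * (W k - W (k + 1) + e k) ^ α + C * (W k - W (k + 1)) + tailSum e k

lemma KLRecursion.eventually_le_of_one_le {W e : ℕ → ℝ} {α C : ℝ} (hrec : KLRecursion W e α C)
    (hα : 1 ≤ α) (hC : 0 ≤ C) (hW0 : Tendsto W atTop (𝓝 0)) (he : ∀ k, 0 ≤ e k)
    (hes : Summable e) :
    ∃ ρ C' : ℝ, 0 ≤ ρ ∧ ρ < 1 ∧ 0 ≤ C' ∧
      ∀ᶠ k in atTop, W (k + 1) ≤ ρ * W k + C' * tailSum e k := by
  have hsmall : ∀ᶠ k in atTop, W k - W (k + 1) + e k ≤ 1 := by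
    have : Tendsto (fun k => W k - W (k + 1) + e k) atTop (𝓝 (0 - 0 + 0)) :=
      (hW0.sub (hW0.comp (tendsto_add_atTop_nat 1))).add hes.tendsto_atTop_zero
    exact this.eventually_le_const (by norm_num)
  have h1 : 0 < 1 + 2 * C := by positivity
  refine ⟨2 * C / (1 + 2 * C), (C + 1) / (1 + 2 * C), by positivity,
    by rw [div_lt_one h1]; linarith, by positivity, ?_⟩
  filter_upwards [hrec, hsmall] with k hk hk1
  have h2 : 0 ≤ W k - W (k + 1) + e k := by linarith [he k, hk.1]
  have h3 : (W k - W (k + 1) + e k) ^ α ≤ W k - W (k + 1) + e k := by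
    simpa using Real.rpow_le_rpow_of_exponent_ge' h2 hk1 zero_le_one hα
  have h4 : e k ≤ tailSum e k := by
    rw [tailSum_eq_add hes]; linarith [tailSum_nonneg he (k + 1)]
  have h5 := mul_le_mul_of_nonneg_left h3 hC
  have h6 := mul_le_mul_of_nonneg_left h4 hC
  rw [div_mul_eq_mul_div, div_mul_eq_mul_div, ← add_div, le_div_iff₀ h1]
  linarith [hk.1, hk.2]

theorem KLRecursion.isBigO_geometric {W e : ℕ → ℝ} {α C : ℝ} (hrec : KLRecursion W e α C)
    (hα : 1 ≤ α) (hC : 0 ≤ C) (hW : ∀ k, 0 ≤ W k) (hW0 : Tendsto W atTop (𝓝 0))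
    (he : ∀ k, 0 ≤ e k) (hes : Summable e) {r B : ℝ} (hr : 0 ≤ r) (hr1 : r < 1) (hB : 0 ≤ B)
    (heB : ∀ k, e k ≤ B * r ^ k) :
    ∃ σ : ℝ, 0 < σ ∧ σ < 1 ∧ W =O[atTop] fun k : ℕ => σ ^ k := by
  obtain ⟨ρ, C', hρ, hρ1, hC', h⟩ := hrec.eventually_le_of_one_le hα hC hW0 he hes
  have hr' : 0 < 1 - r := by linarith
  refine isBigO_geometric_of_le (C := C' * (B / (1 - r))) hW hρ hρ1 hr1 hr (by positivity) ?_
  filter_upwards [h] with k hk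
  have := mul_le_mul_of_nonneg_left (tailSum_le_of_le_geometric he hr hr1 hB heB k) hC'
  rw [mul_assoc]; linarith

theorem KLRecursion.isBigO_rpow {W e : ℕ → ℝ} {α C : ℝ} (hrec : KLRecursion W e α C)
    (hα : 1 ≤ α) (hC : 0 ≤ C) (hW : ∀ k, 0 ≤ W k) (hW0 : Tendsto W atTop (𝓝 0))
    (he : ∀ k, 0 ≤ e k) (hes : Summable e) {p B : ℝ} (hp : 0 < p) (hB : 0 ≤ B)
    (heB : ∀ k : ℕ, 1 ≤ k → e k ≤ B * (k : ℝ) ^ (-(p + 1))) :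
    W =O[atTop] fun k : ℕ => (k : ℝ) ^ (-p) := by
  obtain ⟨ρ, C', hρ, hρ1, hC', h⟩ := hrec.eventually_le_of_one_le hα hC hW0 he hes
  refine isBigO_rpow_of_le (C := C' * (B * 2 ^ (p + 1) / p)) hW hρ hρ1 hp.le (by positivity) ?_
  filter_upwards [h, eventually_ge_atTop 1] with k hk hk1
  have := mul_le_mul_of_nonneg_left (tailSum_le_of_le_rpow he hp hB heB hk1) hC'
  rw [mul_assoc]; linarith

/-- If the exponent `α` is below one, the recursion still forces the rate `k ^ (-p)` for each
`p ≤ α / (1 - α)` that the errors permit: were `W (k + 1)` above `M (k + 1) ^ (-p)` while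
`W k ≤ M k ^ (-p)`, the increment would be `O (M k ^ (-p - 1))`, and its power `α` too small. -/
theorem KLRecursion.isBigO_rpow_of_lt_one {W e : ℕ → ℝ} {α C : ℝ} (hrec : KLRecursion W e α C)
    (hα0 : 0 < α) (hα : α < 1) (hC : 0 ≤ C) (hW : ∀ k, 0 ≤ W k)
    (hW0 : Tendsto W atTop (𝓝 0)) (he : ∀ k, 0 ≤ e k) (hes : Summable e) {p B : ℝ} (hp : 0 < p)
    (hpα : p ≤ α / (1 - α)) (hB : 0 ≤ B)
    (heB : ∀ k : ℕ, 1 ≤ k → e k ≤ B * (k : ℝ) ^ (-(p + 1))) :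
    W =O[atTop] fun k : ℕ => (k : ℝ) ^ (-p) := by
  have hsmall : ∀ᶠ k in atTop, W k - W (k + 1) + e k ≤ 1 := by
    have : Tendsto (fun k => W k - W (k + 1) + e k) atTop (𝓝 (0 - 0 + 0)) :=
      (hW0.sub (hW0.comp (tendsto_add_atTop_nat 1))).add hes.tendsto_atTop_zero
    exact this.eventually_le_const (by norm_num)
  obtain ⟨N, hN⟩ := eventually_atTop.1 ((hrec.and hsmall).and (eventually_ge_atTop 1))
  set B' := B * 2 ^ (p + 1) / p with hB'
  have hB'0 : 0 ≤ B' := by positivity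
  -- `M` is large enough that `M` dominates the sublinear term `(M p + B) ^ α`
  obtain ⟨M, hM0, hM1, hM2⟩ : ∃ M : ℝ, 0 ≤ M ∧ W N / (N : ℝ) ^ (-p) ≤ M ∧
      2 ^ p * (2 * C * (M * p + B) ^ α + B') ≤ M := by
    have hlin : Tendsto (fun M : ℝ => M * p + B) atTop atTop :=
      tendsto_atTop_add_const_right _ _ (tendsto_id.atTop_mul_const hp)
    have ho : (fun y : ℝ => y ^ α) =o[atTop] fun y : ℝ => y := by
      refine isLittleO_of_tendsto' ?_ ((tendsto_rpow_neg_atTop (sub_pos.2 hα)).congr' ?_)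
      · filter_upwards [eventually_gt_atTop 0] with y hy h0 using absurd h0 hy.ne'
      · filter_upwards [eventually_gt_atTop 0] with y hy
        rw [neg_sub, Real.rpow_sub_one hy.ne']
    set η : ℝ := 1 / (2 ^ p * (2 * C + 1) * p * 2) with hη
    have hη0 : 0 < η := by positivity
    have h1 := hlin.eventually (ho.def hη0)
    obtain ⟨M, hM⟩ := (((h1.and (eventually_ge_atTop 0)).and
      (eventually_ge_atTop (W N / (N : ℝ) ^ (-p)))).and
      (eventually_ge_atTop (B / p + 2 * (2 ^ p * B')))).exists
    obtain ⟨⟨⟨hM1, hM2⟩, hM3⟩, hM4⟩ := hM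
    refine ⟨M, hM2, hM3, ?_⟩
    have hy : 0 ≤ M * p + B := by positivity
    rw [Real.norm_of_nonneg (by positivity), Real.norm_of_nonneg hy] at hM1
    have h2 : 2 ^ p * (2 * C * (M * p + B) ^ α) ≤ (M * p + B) / (2 * p) := by
      calc 2 ^ p * (2 * C * (M * p + B) ^ α) ≤ 2 ^ p * ((2 * C + 1) * (M * p + B) ^ α) := by
            gcongr; linarith
        _ ≤ 2 ^ p * ((2 * C + 1) * (η * (M * p + B))) := by gcongr
        _ = (M * p + B) / (2 * p) := by rw [hη]; field_simp
    have h3 : (M * p + B) / (2 * p) = (M + B / p) / 2 := by field_simp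
    rw [mul_add]
    linarith
  have key : ∀ k ≥ N, W k ≤ M * (k : ℝ) ^ (-p) := by
    intro k hk
    induction k, hk using Nat.le_induction with
    | base =>
      have : (0 : ℝ) < N := by exact_mod_cast (hN N le_rfl).2
      rw [← div_le_iff₀ (by positivity)]; exact hM1
    | succ k hk ih =>
      obtain ⟨⟨⟨hk1, hk2⟩, hk3⟩, hk4⟩ := hN k hk
      have hk0 : (0 : ℝ) < k := by exact_mod_cast hk4
      have hk0' : (1 : ℝ) ≤ k := by exact_mod_cast hk4
      by_contra! hcon
      set X := W k - W (k + 1) + e k with hX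
      have hX0 : 0 ≤ X := by linarith [he k]
      have h1 : X ≤ (M * p + B) * (k : ℝ) ^ (-(p + 1)) := by
        have := mul_le_mul_of_nonneg_left (rpow_neg_sub_rpow_neg_succ_le hp.le hk4) hM0
        have := heB k hk4
        rw [add_mul, mul_assoc]; linarith
      have h2 : X ^ α ≤ (M * p + B) ^ α * (k : ℝ) ^ (-p) := by
        calc X ^ α ≤ ((M * p + B) * (k : ℝ) ^ (-(p + 1))) ^ α :=
              Real.rpow_le_rpow hX0 h1 hα0.le
          _ = (M * p + B) ^ α * (k : ℝ) ^ (-(p + 1) * α) := by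
              rw [Real.mul_rpow (by positivity) (by positivity), ← Real.rpow_mul hk0.le]
          _ ≤ (M * p + B) ^ α * (k : ℝ) ^ (-p) := by
              refine mul_le_mul_of_nonneg_left
                (Real.rpow_le_rpow_of_exponent_le hk0' ?_) (by positivity)
              rw [le_div_iff₀ (by linarith)] at hpα
              linarith
      have h3 : X ≤ X ^ α := by
        simpa using Real.rpow_le_rpow_of_exponent_ge' hX0 hk3 hα0.le hα.le
      have h4 := tailSum_le_of_le_rpow he hp hB heB hk4
      have h5 : W (k + 1) ≤ 2 * C * X ^ α + tailSum e k := by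
        have : C * (W k - W (k + 1)) ≤ C * X ^ α := by
          gcongr; linarith [he k]
        linarith
      have h6 : W (k + 1) ≤ (2 * C * (M * p + B) ^ α + B') * (k : ℝ) ^ (-p) := by
        have : 2 * C * X ^ α ≤ 2 * C * ((M * p + B) ^ α * (k : ℝ) ^ (-p)) := by gcongr
        rw [add_mul, mul_assoc (2 * C)]; linarith
      have h7 := rpow_neg_le_two_rpow_mul_succ hp.le hk4
      have h8 : (2 * C * (M * p + B) ^ α + B') * (k : ℝ) ^ (-p)
          ≤ (2 * C * (M * p + B) ^ α + B') * (2 ^ p * ((k + 1 : ℕ) : ℝ) ^ (-p)) := by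
        gcongr
      have h9 : 2 ^ p * (2 * C * (M * p + B) ^ α + B') * ((k + 1 : ℕ) : ℝ) ^ (-p)
          ≤ M * ((k + 1 : ℕ) : ℝ) ^ (-p) := by gcongr
      linarith
  refine IsBigO.of_bound M (eventually_atTop.2 ⟨N, fun k hk => ?_⟩)
  rw [Real.norm_of_nonneg (hW k), Real.norm_of_nonneg (by positivity)]
  exact key k hk

/-! ### Convergence of descent sequences under the Kurdyka–Łojasiewicz inequality -/

/-- The step estimate obtained from sufficient decrease `b D'² ≤ u - v`, the
Kurdyka–Łojasiewicz bound `u ^ θ ≤ C R`, and the concavity of `s ↦ s ^ (1 - θ)`. -/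
lemma step_le_of_kl {b C θ u v R D' : ℝ} (hb : 0 < b) (hC : 0 ≤ C) (hθ₀ : 0 ≤ θ) (hθ₁ : θ < 1)
    (hu : 0 ≤ u) (hv : 0 ≤ v) (hR : 0 ≤ R) (hdesc : v + b * D' ^ 2 ≤ u)
    (hkl : u ^ θ ≤ C * R) :
    D' ≤ R / 2 + C / (2 * b * (1 - θ)) * (u ^ (1 - θ) - v ^ (1 - θ)) := by
  have hθ : 0 < 1 - θ := by linarith
  have hvu : v ≤ u := by nlinarith [sq_nonneg D']
  set P := u ^ (1 - θ) - v ^ (1 - θ) with hP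
  have hP0 : 0 ≤ P := sub_nonneg.2 (Real.rpow_le_rpow hv hvu hθ.le)
  have hyoung := Real.geom_mean_le_arith_mean2_weighted hθ₀ hθ.le hu hv (by ring)
  have hsplit : u ^ θ * u ^ (1 - θ) = u := by
    rw [← Real.rpow_add_of_nonneg hu hθ₀ hθ.le]; simp
  have h1 : (1 - θ) * (u - v) ≤ u ^ θ * P := by
    have : u ^ θ * P = u - u ^ θ * v ^ (1 - θ) := by rw [hP, mul_sub, hsplit]
    linarith
  have h2 : (1 - θ) * (b * D' ^ 2) ≤ C * R * P :=
    (mul_le_mul_of_nonneg_left (by linarith) hθ.le).trans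
      (h1.trans (mul_le_mul_of_nonneg_right hkl hP0))
  have hB : 0 ≤ C / (2 * b * (1 - θ)) * P := by positivity
  refine le_of_sq_le_sq ?_ (by positivity)
  have h3 : D' ^ 2 ≤ 4 * (R / 2) * (C / (2 * b * (1 - θ)) * P) := by
    have : 4 * (R / 2) * (C / (2 * b * (1 - θ)) * P) = C * R * P / ((1 - θ) * b) := by
      field_simp; ring
    rw [this, le_div_iff₀ (by positivity)]
    linarith
  nlinarith [sq_nonneg (R / 2 - C / (2 * b * (1 - θ)) * P)]

section KLDescent

variable {E : Type*} [NormedAddCommGroup E]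

/-- A majorant of the distance from `x k` to the limit: a step, the desingularized objective gap
and the remaining errors. -/
noncomputable def klMajorant (x : ℕ → E) (φ e : ℕ → ℝ) (θ c : ℝ) (k : ℕ) : ℝ :=
  2 * ‖x (k + 1) - x k‖ + 2 * c * φ (k + 1) ^ (1 - θ) + tailSum e k

variable {x : ℕ → E} {φ e : ℕ → ℝ} {θ b : ℝ}

lemma klMajorant_nonneg (hφ : ∀ k, 0 ≤ φ k) (he : ∀ k, 0 ≤ e k) {c : ℝ} (hc : 0 ≤ c) (k : ℕ) :
    0 ≤ klMajorant x φ e θ c k := by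
  have := tailSum_nonneg he k
  have := Real.rpow_nonneg (hφ (k + 1)) (1 - θ)
  unfold klMajorant
  positivity

lemma tendsto_step_of_descent (hb : 0 < b)
    (hdesc : ∀ k, φ (k + 1) + b * ‖x (k + 1) - x k‖ ^ 2 ≤ φ k)
    (hφ0 : Tendsto φ atTop (𝓝 0)) :
    Tendsto (fun k => ‖x (k + 1) - x k‖) atTop (𝓝 0) := by
  have h1 : Tendsto (fun k => (φ k - φ (k + 1)) / b) atTop (𝓝 0) := by
    simpa using (hφ0.sub (hφ0.comp (tendsto_add_atTop_nat 1))).div_const b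
  have h2 : Tendsto (fun k => ‖x (k + 1) - x k‖ ^ 2) atTop (𝓝 0) :=
    squeeze_zero (fun _ => by positivity)
      (fun k => by rw [le_div_iff₀ hb]; linarith [hdesc k]) h1
  simpa using h2.sqrt

/-- Finite length under a local Kurdyka–Łojasiewicz inequality at a cluster point `xs`: the
sequence converges to `xs`. The potential `‖x k - xs‖ + klMajorant k` decreases as long as it is
below the radius `μ` of validity, and it is arbitrarily small infinitely often. -/
theorem tendsto_of_kl {xs : E} {μ C : ℝ} (hb : 0 < b) (hθ₀ : 0 ≤ θ) (hθ₁ : θ < 1)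
    (hμ : 0 < μ) (hC : 0 ≤ C) (hφ : ∀ k, 0 ≤ φ k)
    (hdesc : ∀ k, φ (k + 1) + b * ‖x (k + 1) - x k‖ ^ 2 ≤ φ k)
    (hφ0 : Tendsto φ atTop (𝓝 0)) (he : ∀ k, 0 ≤ e k) (hes : Summable e)
    (hcl : MapClusterPt xs atTop x)
    (hkl : ∀ᶠ k in atTop, ‖x (k + 1) - xs‖ < μ →
      φ (k + 1) ^ θ ≤ C * (‖x (k + 1) - x k‖ + e k)) :
    Tendsto x atTop (𝓝 xs) ∧ ∃ c, 0 ≤ c ∧ Tendsto (klMajorant x φ e θ c) atTop (𝓝 0) ∧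
      ∀ᶠ k in atTop, ‖x k - xs‖ ≤ klMajorant x φ e θ c k ∧
        ‖x (k + 1) - x k‖ ≤ klMajorant x φ e θ c k - klMajorant x φ e θ c (k + 1) := by
  have hθ : 0 < 1 - θ := by linarith
  set c := C / (2 * b * (1 - θ)) with hc
  have hc0 : 0 ≤ c := by positivity
  set W := klMajorant x φ e θ c with hW
  have hW_nonneg : ∀ k, 0 ≤ W k := klMajorant_nonneg hφ he hc0
  have hD := tendsto_step_of_descent hb hdesc hφ0
  have hW0 : Tendsto W atTop (𝓝 0) := by
    have h1 : Tendsto (fun k => φ (k + 1) ^ (1 - θ)) atTop (𝓝 0) := by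
      have := (hφ0.comp (tendsto_add_atTop_nat 1)).rpow_const (p := 1 - θ) (Or.inr hθ.le)
      simpa [Real.zero_rpow hθ.ne'] using this
    have := ((hD.const_mul 2).add (h1.const_mul (2 * c))).add (tendsto_tailSum e)
    simp only [mul_zero, add_zero] at this
    exact this
  obtain ⟨N₀, hN₀⟩ := eventually_atTop.1 hkl
  have hstep : ∀ k ≥ N₀, ‖x (k + 1) - xs‖ < μ → ‖x (k + 1) - x k‖ ≤ W k - W (k + 1) := by
    intro k hk hball
    have := step_le_of_kl hb hC hθ₀ hθ₁ (hφ (k + 1)) (hφ (k + 2))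
      (add_nonneg (norm_nonneg (x (k + 1) - x k)) (he k)) (hdesc (k + 1)) (hN₀ k hk hball)
    simp only [hW, klMajorant, tailSum_eq_add hes k]
    linarith
  have hdist : ∀ k, ‖x (k + 1) - xs‖ ≤ ‖x k - xs‖ + ‖x (k + 1) - x k‖ := fun k => by
    rw [add_comm ‖x k - xs‖]; exact norm_sub_le_norm_sub_add_norm_sub _ _ _
  have hstart : ∀ r > 0, ∃ N ≥ N₀, ‖x N - xs‖ + W N < r := by
    intro r hr
    have h1 : ∃ᶠ k in atTop, ‖x k - xs‖ < r / 2 := by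
      have := hcl.frequently (Metric.ball_mem_nhds xs (half_pos hr))
      simpa only [Metric.mem_ball, dist_eq_norm, Function.comp_def] using this
    have h2 : ∀ᶠ k in atTop, W k < r / 2 := hW0.eventually_lt_const (half_pos hr)
    obtain ⟨N, hN⟩ := (h1.and_eventually (h2.and (eventually_ge_atTop N₀))).exists
    exact ⟨N, hN.2.2, by linarith [hN.1, hN.2.1]⟩
  have htrap : ∀ r, r ≤ μ → ∀ N ≥ N₀, ‖x N - xs‖ + W N < r →
      ∀ k ≥ N, ‖x k - xs‖ + W k < r := by
    intro r hr N hN hNr k hk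
    induction k, hk using Nat.le_induction with
    | base => exact hNr
    | succ k hk ih =>
      have hDk : ‖x (k + 1) - x k‖ ≤ W k := by
        have := Real.rpow_nonneg (hφ (k + 1)) (1 - θ)
        have : 0 ≤ 2 * c * φ (k + 1) ^ (1 - θ) := by positivity
        have := tailSum_nonneg he k
        simp only [hW, klMajorant]
        linarith [norm_nonneg (x (k + 1) - x k)]
      have := hstep k (hN.trans hk) (by linarith [hdist k])
      linarith [hdist k]
  have hlim : Tendsto x atTop (𝓝 xs) := by
    rw [Metric.tendsto_atTop]
    intro r hr
    obtain ⟨N, hN, hNr⟩ := hstart (min r μ) (lt_min hr hμ)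
    refine ⟨N, fun k hk => ?_⟩
    rw [dist_eq_norm]
    have := htrap _ (min_le_right _ _) N hN hNr k hk
    linarith [hW_nonneg k, min_le_left r μ]
  have hball : ∀ᶠ k in atTop, ‖x (k + 1) - xs‖ < μ := by
    have := (hlim.comp (tendsto_add_atTop_nat 1)).eventually (Metric.ball_mem_nhds xs hμ)
    simpa only [Metric.mem_ball, dist_eq_norm, Function.comp_def] using this
  obtain ⟨N₁, hN₁⟩ := eventually_atTop.1 hball
  refine ⟨hlim, c, hc0, hW0, eventually_atTop.2 ⟨max N₀ N₁, fun k hk => ?_⟩⟩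
  have hstep' : ∀ j ≥ max N₀ N₁, ‖x (j + 1) - x j‖ ≤ W j - W (j + 1) := fun j hj =>
    hstep j (le_of_max_le_left hj) (hN₁ j (le_of_max_le_right hj))
  refine ⟨?_, hstep' k hk⟩
  have htel : ∀ j ≥ k, ‖x k - x j‖ ≤ W k - W j := by
    intro j hj
    induction j, hj using Nat.le_induction with
    | base => simp
    | succ j hj ih =>
      have h1 := norm_sub_le_norm_sub_add_norm_sub (x k) (x j) (x (j + 1))
      rw [norm_sub_rev (x j)] at h1
      linarith [hstep' j (hk.trans hj)]
  have h1 : Tendsto (fun j => ‖x k - x j‖) atTop (𝓝 ‖x k - xs‖) :=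
    (tendsto_const_nhds.sub hlim).norm
  exact le_of_tendsto h1 (eventually_atTop.2 ⟨k, fun j hj =>
    (htel j hj).trans (by linarith [hW_nonneg j])⟩)

/-- For a positive exponent `θ`, the majorant of `tendsto_of_kl` obeys the recursion with
`α = (1 - θ) / θ`. -/
theorem klRecursion_klMajorant {C c : ℝ} (hθ₀ : 0 < θ) (hθ₁ : θ < 1) (hC : 0 ≤ C) (hc : 0 ≤ c)
    (hφ : ∀ k, 0 ≤ φ k) (he : ∀ k, 0 ≤ e k)
    (hstep : ∀ᶠ k in atTop, ‖x (k + 1) - x k‖ ≤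
      klMajorant x φ e θ c k - klMajorant x φ e θ c (k + 1))
    (hkl : ∀ᶠ k in atTop, φ (k + 1) ^ θ ≤ C * (‖x (k + 1) - x k‖ + e k)) :
    ∃ C', 0 ≤ C' ∧ KLRecursion (klMajorant x φ e θ c) e ((1 - θ) / θ) C' := by
  have hθ : 0 < 1 - θ := by linarith
  set α := (1 - θ) / θ with hα
  have hα0 : 0 < α := by positivity
  refine ⟨2 * c * C ^ α + 2, by positivity, ?_⟩
  filter_upwards [hstep, hkl] with k hk hk'
  set W := klMajorant x φ e θ c
  have hn := norm_nonneg (x (k + 1) - x k)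
  refine ⟨by linarith, ?_⟩
  set X := W k - W (k + 1)
  have h1 : φ (k + 1) ^ (1 - θ) ≤ C ^ α * (X + e k) ^ α := by
    have : φ (k + 1) ^ (1 - θ) = (φ (k + 1) ^ θ) ^ α := by
      rw [← Real.rpow_mul (hφ _), hα, mul_div_cancel₀ _ hθ₀.ne']
    rw [this, ← Real.mul_rpow hC (by linarith [he k])]
    refine Real.rpow_le_rpow (Real.rpow_nonneg (hφ _) _) (hk'.trans ?_) hα0.le
    gcongr
  have h2 : 0 ≤ (X + e k) ^ α := Real.rpow_nonneg (by linarith [he k]) _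
  have h3 : 2 * c * φ (k + 1) ^ (1 - θ) ≤ 2 * c * (C ^ α * (X + e k) ^ α) := by gcongr
  have h4 : 0 ≤ 2 * c * C ^ α * X := by
    have : 0 ≤ X := hn.trans hk
    positivity
  have h5 : W k = 2 * ‖x (k + 1) - x k‖ + 2 * c * φ (k + 1) ^ (1 - θ) + tailSum e k := rfl
  linarith

end KLDescent

/-! ### Smooth and convex calculus -/

section Calculus

variable {V : Type*} [NormedAddCommGroup V] [InnerProductSpace ℝ V] [CompleteSpace V]

/-- The quadratic upper bound for a function with `L`-Lipschitz gradient. -/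
lemma le_add_inner_gradient_add_sq {h : V → ℝ} {L : ℝ} (hd : Differentiable ℝ h)
    (hL : ∀ x y, ‖gradient h x - gradient h y‖ ≤ L * ‖x - y‖) (x s : V) :
    h (x + s) ≤ h x + inner ℝ (gradient h x) s + L / 2 * ‖s‖ ^ 2 := by
  set φ : ℝ → ℝ := fun t => h (x + t • s) - t * inner ℝ (gradient h x) s - L / 2 * ‖s‖ ^ 2 * t ^ 2
  have hder : ∀ t, HasDerivAt φ (inner ℝ (gradient h (x + t • s)) s - inner ℝ (gradient h x) s
      - L * ‖s‖ ^ 2 * t) t := by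
    intro t
    have h1 : HasDerivAt (fun t : ℝ => x + t • s) s t := by
      simpa using ((hasDerivAt_id t).smul_const s).const_add x
    have h2 := (hd (x + t • s)).hasGradientAt.hasFDerivAt.comp_hasDerivAt t h1
    have h3 := (h2.sub ((hasDerivAt_id t).mul_const (inner ℝ (gradient h x) s))).sub
      ((hasDerivAt_pow 2 t).const_mul (L / 2 * ‖s‖ ^ 2))
    refine h3.congr_deriv ?_
    simp
    ring
  have hanti : AntitoneOn φ (Set.Icc 0 1) := by
    refine antitoneOn_of_deriv_nonpos (convex_Icc 0 1)
      (fun t _ => (hder t).continuousAt.continuousWithinAt)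
      (fun t _ => (hder t).differentiableAt.differentiableWithinAt) fun t ht => ?_
    rw [interior_Icc] at ht
    rw [(hder t).deriv, ← inner_sub_left]
    have h1 := real_inner_le_norm (gradient h (x + t • s) - gradient h x) s
    have h2 := hL (x + t • s) x
    rw [add_sub_cancel_left, norm_smul, Real.norm_of_nonneg ht.1.le] at h2
    have h3 := mul_le_mul_of_nonneg_right h2 (norm_nonneg s)
    nlinarith
  have := hanti (Set.left_mem_Icc.2 zero_le_one) (Set.right_mem_Icc.2 zero_le_one) zero_le_one
  simp only [φ, one_smul, zero_smul, add_zero] at this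
  linarith

/-- At a point of differentiability, a convex subgradient is the gradient. -/
lemma eq_gradient_of_forall_le {g : V → ℝ} {x y : V} (hd : DifferentiableAt ℝ g x)
    (hy : ∀ z, g x + inner ℝ y (z - x) ≤ g z) : y = gradient g x := by
  have hmin : IsLocalMin (fun z => g z - inner ℝ y z) x := by
    refine Eventually.of_forall fun z => ?_
    have := hy z
    rw [inner_sub_right] at this
    show g x - inner ℝ y x ≤ g z - inner ℝ y z
    linarith
  have h1 : HasFDerivAt (fun z => g z - inner ℝ y z)
      (InnerProductSpace.toDual ℝ V (gradient g x) - innerSL ℝ y) x :=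
    hd.hasGradientAt.hasFDerivAt.sub (innerSL ℝ y).hasFDerivAt
  have h2 := hmin.hasFDerivAt_eq_zero h1
  refine ext_inner_right ℝ fun z => ?_
  have h3 : inner ℝ (gradient g x) z - inner ℝ y z = 0 :=
    congrArg (fun T : V →L[ℝ] ℝ => T z) h2
  linarith

/-- A positive symmetric operator whose quadratic form is at most `c ‖v‖²` has norm at
most `c`. -/
lemma LinearMap.IsPositive.norm_apply_le {E : Type*} [NormedAddCommGroup E]
    [InnerProductSpace ℝ E] {T : E →ₗ[ℝ] E} (hT : T.IsPositive) {c : ℝ} (hc : 0 < c)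
    (hle : ∀ v, inner ℝ (T v) v ≤ c * ‖v‖ ^ 2) (v : E) : ‖T v‖ ≤ c * ‖v‖ := by
  -- positivity of the form at `T v - c v`
  have h1 := hT.re_inner_nonneg_left (T v - c • v)
  have hsymm : inner ℝ (T (T v)) v = inner ℝ (T v) (T v) := hT.isSymmetric (T v) v
  have h2 := hle (T v)
  have h3 := hle v
  simp only [map_sub, map_smul, inner_sub_left, inner_sub_right, inner_smul_left,
    inner_smul_right, RCLike.re_to_real, conj_trivial, hsymm,
    real_inner_self_eq_norm_sq] at h1
  have h4 : c * (c * inner ℝ (T v) v) ≤ c * (c * (c * ‖v‖ ^ 2)) := by gcongr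
  have h5 : c * ‖T v‖ ^ 2 ≤ c * (c * ‖v‖) ^ 2 := by nlinarith
  exact le_of_sq_le_sq (le_of_mul_le_mul_left h5 hc) (by positivity)

end Calculus

section Metric

variable {n : ℕ} {A : Matrix (Fin n) (Fin n) ℝ}

lemma Matrix.toEuclideanLin_one_apply (v : RSpace n) :
    (1 : Matrix (Fin n) (Fin n) ℝ).toEuclideanLin v = v := by
  simp

lemma Matrix.mul_norm_sq_le_inner_of_posSemidef {c : ℝ}
    (hA : (A - c • (1 : Matrix (Fin n) (Fin n) ℝ)).PosSemidef) (v : RSpace n) :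
    c * ‖v‖ ^ 2 ≤ inner ℝ (A.toEuclideanLin v) v := by
  have h := (Matrix.isPositive_toEuclideanLin_iff.2 hA).re_inner_nonneg_left v
  rw [map_sub, map_smul, LinearMap.sub_apply, LinearMap.smul_apply,
    Matrix.toEuclideanLin_one_apply, inner_sub_left, inner_smul_left] at h
  simp only [RCLike.re_to_real, conj_trivial, real_inner_self_eq_norm_sq] at h
  linarith

lemma Matrix.norm_toEuclideanLin_le_of_posSemidef {c : ℝ} (hc : 0 < c) (hpos : A.PosSemidef)
    (hA : (c • (1 : Matrix (Fin n) (Fin n) ℝ) - A).PosSemidef) (v : RSpace n) :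
    ‖A.toEuclideanLin v‖ ≤ c * ‖v‖ := by
  refine (Matrix.isPositive_toEuclideanLin_iff.2 hpos).norm_apply_le hc (fun v => ?_) v
  have h := (Matrix.isPositive_toEuclideanLin_iff.2 hA).re_inner_nonneg_left v
  rw [map_sub, map_smul, LinearMap.sub_apply, LinearMap.smul_apply,
    Matrix.toEuclideanLin_one_apply, inner_sub_left, inner_smul_left] at h
  simp only [RCLike.re_to_real, conj_trivial, real_inner_self_eq_norm_sq] at h
  linarith

end Metric

/-! ### Regular subgradients of the fractional objective and of the auxiliary function -/

section Subdifferential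

lemma regSubdiff_subset_limSubdiff {V : Type*} [NormedAddCommGroup V] [InnerProductSpace ℝ V]
    (φ : V → EReal) (x : V) : regSubdiff φ x ⊆ limSubdiff φ x := fun d hd =>
  ⟨hd.1, hd.2.1, fun _ => x, fun _ => d, tendsto_const_nhds, tendsto_const_nhds,
    fun _ => hd, tendsto_const_nhds⟩

variable {n : ℕ} {f : RSpace n → EReal} {h g : RSpace n → ℝ} {x : RSpace n}

lemma fracObj_eq_coe (hf : f x ≠ ⊤) (hg : g x ≠ 0) :
    fracObj f h g x = (ratioAt f h g x : EReal) := by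
  rw [fracObj, if_pos ⟨hf, hg⟩, ratioAt]

/-- The quotient rule: replacing `f` by its affine minorant at `x` gives a minorant of
`(f + h) / g` that is differentiable at `x` and exact there. -/
lemma eventually_le_fracObj (hbot : ∀ z, f z ≠ ⊥) (hpos : ∀ z, f z ≠ ⊤ → g z ≠ 0 → 0 < g z)
    (hgx : g x ≠ 0) (hh : DifferentiableAt ℝ h x) (hg : DifferentiableAt ℝ g x)
    {d : RSpace n} (hd : d ∈ epsSubdiff 0 f x) {η : ℝ} (hη : 0 < η) :
    ∀ᶠ z in 𝓝 x, ((ratioAt f h g x + inner ℝ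
      ((g x)⁻¹ • (d + gradient h x - ratioAt f h g x • gradient g x)) (z - x)
      - η * ‖z - x‖ : ℝ) : EReal) ≤ fracObj f h g z := by
  set w := (g x)⁻¹ • (d + gradient h x - ratioAt f h g x • gradient g x) with hw
  set G : RSpace n → ℝ := fun z => ((f x).toReal + inner ℝ d (z - x) + h z) / g z with hG
  have hGx : G x = ratioAt f h g x := by simp [hG, ratioAt]
  have hnum : HasFDerivAt (fun z => (f x).toReal + inner ℝ d (z - x) + h z)
      (innerSL ℝ d + InnerProductSpace.toDual ℝ _ (gradient h x)) x := by
    have h1 : HasFDerivAt (fun z => inner ℝ d (z - x)) (innerSL ℝ d) x :=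
      (innerSL ℝ d).hasFDerivAt.comp x ((hasFDerivAt_id x).sub_const x)
    exact (h1.const_add _).add hh.hasGradientAt.hasFDerivAt
  have hder : HasFDerivAt G _ x :=
    hnum.mul ((hasDerivAt_inv hgx).comp_hasFDerivAt x hg.hasGradientAt.hasFDerivAt)
  have ho := hder.isLittleO.def hη
  filter_upwards [ho] with z hz
  by_cases hfz : f z ≠ ⊤ ∧ g z ≠ 0
  · rw [fracObj_eq_coe hfz.1 hfz.2, EReal.coe_le_coe_iff]
    have hgz := hpos z hfz.1 hfz.2
    have h1 : (f x).toReal + inner ℝ d (z - x) ≤ (f z).toReal := by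
      have := hd.2 z
      rw [← EReal.coe_toReal hfz.1 (hbot z), EReal.coe_le_coe_iff] at this
      linarith
    have h2 : G z ≤ ratioAt f h g z := by
      simp only [hG, ratioAt]
      gcongr
    rw [Real.norm_eq_abs] at hz
    have h3 : -(η * ‖z - x‖) ≤ G z - G x - (((f x).toReal + inner ℝ d (x - x) + h x) *
        (-(g x ^ 2)⁻¹ * inner ℝ (gradient g x) (z - x)) +
        (g x)⁻¹ * (inner ℝ d (z - x) + inner ℝ (gradient h x) (z - x))) := (abs_le.1 hz).1
    have h4 : inner ℝ w (z - x) = ((g x * (inner ℝ d (z - x) + inner ℝ (gradient h x) (z - x)) -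
        ((f x).toReal + h x) * inner ℝ (gradient g x) (z - x)) / g x ^ 2) := by
      rw [hw, inner_smul_left, inner_sub_left, inner_add_left, inner_smul_left, ratioAt]
      simp only [conj_trivial]
      field_simp
    have h5 : G z - G x - inner ℝ w (z - x) ≥ -(η * ‖z - x‖) := by
      refine h3.trans (le_of_eq ?_)
      rw [h4, sub_self, inner_zero_right]
      field_simp
      ring
    linarith
  · rw [fracObj, if_neg hfz]
    exact le_top

variable {τ : ℝ}

/-- The tangent inequality for `t ↦ t ^ τ / τ` on the half line. -/
lemma rpow_div_add_mul_sub_le (hτ : 1 < τ) {t s : ℝ} (ht : 0 ≤ t) (hs : 0 ≤ s) :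
    t ^ τ / τ + t ^ (τ - 1) * (s - t) ≤ s ^ τ / τ := by
  have hτ0 : 0 < τ := by linarith
  have hconj : (τ / (τ - 1)).HolderConjugate τ :=
    (Real.HolderConjugate.conjExponent hτ).symm
  have hyoung := Real.young_inequality_of_nonneg (Real.rpow_nonneg ht (τ - 1)) hs hconj
  rw [← Real.rpow_mul ht, mul_div_cancel₀ _ (by linarith)] at hyoung
  have h1 : t ^ (τ - 1) * t = t ^ τ := by
    nth_rewrite 2 [← Real.rpow_one t]
    rw [← Real.rpow_add_of_nonneg ht (by linarith) zero_le_one]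
    simp
  have h2 : t ^ τ / (τ / (τ - 1)) = t ^ τ - t ^ τ / τ := by
    field_simp
  rw [mul_sub, h1]
  linarith

lemma auxFun_eq_coe {t : ℝ} (ht : 0 ≤ t) (hf : f x ≠ ⊤) (hg : g x ≠ 0) :
    auxFun τ f h g (WithLp.toLp 2 (x, t)) = ((ratioAt f h g x + t ^ τ / τ : ℝ) : EReal) := by
  rw [auxFun, WithLp.toLp_snd, if_pos ht, WithLp.toLp_fst, fracObj_eq_coe hf hg, EReal.coe_add]

lemma mem_regSubdiff_auxFun (hτ : 1 < τ) (hbot : ∀ z, f z ≠ ⊥)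
    (hpos : ∀ z, f z ≠ ⊤ → g z ≠ 0 → 0 < g z)
    (hx : f x ≠ ⊤) (hgx : g x ≠ 0) (hh : DifferentiableAt ℝ h x) (hg : DifferentiableAt ℝ g x)
    {d : RSpace n} (hd : d ∈ epsSubdiff 0 f x) {t : ℝ} (ht : 0 ≤ t) :
    WithLp.toLp 2 ((g x)⁻¹ • (d + gradient h x - ratioAt f h g x • gradient g x), t ^ (τ - 1))
      ∈ regSubdiff (auxFun τ f h g) (WithLp.toLp 2 (x, t)) := by
  rw [regSubdiff, Set.mem_ofPred_eq, auxFun_eq_coe ht hx hgx]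
  refine ⟨EReal.coe_ne_top _, EReal.coe_ne_bot _, fun η hη => ?_⟩
  have hfst : Tendsto (fun p : WithLp 2 (RSpace n × ℝ) => p.fst)
      (𝓝 (WithLp.toLp 2 (x, t))) (𝓝 x) :=
    (WithLp.continuous_fst 2 _ _).tendsto _
  filter_upwards [hfst.eventually (eventually_le_fracObj hbot hpos hgx hh hg hd hη)] with p hp
  by_cases hp2 : 0 ≤ p.snd
  · rw [auxFun, if_pos hp2]
    refine le_trans ?_ (add_le_add_left hp _)
    rw [← EReal.coe_add, EReal.coe_le_coe_iff, EReal.toReal_coe, WithLp.prod_inner_apply]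
    have h1 := rpow_div_add_mul_sub_le hτ ht hp2
    have h2 : ‖p.fst - x‖ ≤ ‖p - WithLp.toLp 2 (x, t)‖ :=
      WithLp.norm_fst_le _ (p - WithLp.toLp 2 (x, t))
    have h3 := mul_le_mul_of_nonneg_left h2 hη.le
    simp only [WithLp.ofLp_sub, Prod.fst_sub, Prod.snd_sub, WithLp.ofLp_fst, WithLp.ofLp_snd,
      Real.inner_apply]
    linarith
  · rw [auxFun, if_neg hp2]
    exact le_top

end Subdifferential

/-! ### Estimates along the algorithm -/

section Algorithm

variable {n : ℕ} {f : RSpace n → EReal} {h g : RSpace n → ℝ} {L : ℝ}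
  {ε : ℕ → ℝ} {H : ℕ → Matrix (Fin n) (Fin n) ℝ} {x y Δ : ℕ → RSpace n} {δ : ℕ → ℝ}

lemma differentiableAt_of_contDiffOn_ne_zero (hg : Continuous g)
    (hC : ContDiffOn ℝ 1 g {z | g z ≠ 0}) {z : RSpace n} (hz : g z ≠ 0) :
    DifferentiableAt ℝ g z :=
  ((hC.contDiffAt ((isOpen_ne_fun hg continuous_const).mem_nhds hz))).differentiableAt one_ne_zero

lemma IsIVPGSA.g_pos (hx : IsIVPGSA f h g ε H x y Δ δ) (hA : BasicAssumptions f h g L) (k : ℕ) :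
    0 < g (x k) :=
  hA.g_pos _ (hx.mem_domain k).1 (hx.mem_domain k).2

lemma IsIVPGSA.ratioAt_nonneg (hx : IsIVPGSA f h g ε H x y Δ δ)
    (hA : BasicAssumptions f h g L) (k : ℕ) : 0 ≤ ratioAt f h g (x k) :=
  div_nonneg (hA.sum_nonneg _ (hx.mem_domain k).1) (hx.g_pos hA k).le

lemma IsIVPGSA.add_inner_le (hx : IsIVPGSA f h g ε H x y Δ δ) (k : ℕ) (z : RSpace n) :
    g (x k) + inner ℝ (y k) (z - x k) ≤ g z := by
  have := (hx.subgrad k).2 z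
  rw [EReal.coe_le_coe_iff, EReal.toReal_coe] at this
  linarith

lemma IsIVPGSA.subgrad_eq_gradient (hx : IsIVPGSA f h g ε H x y Δ δ)
    (hA : BasicAssumptions f h g L) (hC : ContDiffOn ℝ 1 g {z | g z ≠ 0}) (k : ℕ) :
    y k = gradient g (x k) :=
  eq_gradient_of_forall_le
    (differentiableAt_of_contDiffOn_ne_zero hA.g_continuous hC (hx.mem_domain k).2)
    (hx.add_inner_le k)

lemma IsIVPGSA.ratioAt_succ_le (hx : IsIVPGSA f h g ε H x y Δ δ)
    (hA : BasicAssumptions f h g L) {γlo : ℝ}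
    (hH : ∀ k, (H k - γlo • (1 : Matrix (Fin n) (Fin n) ℝ)).PosSemidef) (k : ℕ) :
    ratioAt f h g (x (k + 1)) + (γlo - L / 2) * ‖x (k + 1) - x k‖ ^ 2 / g (x (k + 1)) ≤
      ratioAt f h g (x k) + ε k := by
  obtain ⟨d, hd, hΔ⟩ := hx.inexact k
  set s := x (k + 1) - x k with hs
  set c := ratioAt f h g (x k) with hc
  have hg0 := hx.g_pos hA k
  have hg1 := hx.g_pos hA (k + 1)
  have hf : (f (x (k + 1))).toReal - inner ℝ d s - δ k ≤ (f (x k)).toReal := by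
    have h1 := hd.2 (x k)
    rw [← EReal.coe_toReal (hx.mem_domain k).1 (hA.f_proper.1 _), EReal.coe_le_coe_iff,
      ← neg_sub (x (k + 1)), inner_neg_right] at h1
    linarith
  have hh := le_add_inner_gradient_add_sq (hA.h_contDiff.differentiable one_ne_zero)
    hA.h_lipschitz (x k) s
  rw [hs, add_sub_cancel, ← hs] at hh
  have hgs : c * (g (x k) + inner ℝ (y k) s) ≤ c * g (x (k + 1)) :=
    mul_le_mul_of_nonneg_left (hx.add_inner_le k _) (hx.ratioAt_nonneg hA k)
  have hHs := Matrix.mul_norm_sq_le_inner_of_posSemidef (hH k) s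
  have hinner : inner ℝ (Δ k) s = inner ℝ d s + inner ℝ (gradient h (x k)) s
      - c * inner ℝ (y k) s + inner ℝ ((H k).toEuclideanLin s) s := by
    rw [hΔ, inner_add_left, inner_sub_left, inner_add_left, inner_smul_left]
    simp
  have hcrit := hx.criterion k
  have habs := le_abs_self (inner ℝ (Δ k) s)
  have hsq := sq_nonneg ‖Δ k‖
  have hcg : c * g (x k) = (f (x k)).toReal + h (x k) := div_mul_cancel₀ _ hg0.ne'
  rw [ratioAt, ← add_div, div_le_iff₀ hg1]
  linarith

lemma IsIVPGSA.ratioAt_add_tailSum_antitone (hx : IsIVPGSA f h g ε H x y Δ δ)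
    (hA : BasicAssumptions f h g L) {γlo : ℝ} (hγ : L / 2 < γlo)
    (hH : ∀ k, (H k - γlo • (1 : Matrix (Fin n) (Fin n) ℝ)).PosSemidef) (hε : Summable ε) :
    Antitone fun k => ratioAt f h g (x k) + tailSum ε k := by
  refine antitone_nat_of_succ_le fun k => ?_
  have h1 := hx.ratioAt_succ_le hA hH k
  have h2 := hx.g_pos hA (k + 1)
  have h3 : 0 ≤ (γlo - L / 2) * ‖x (k + 1) - x k‖ ^ 2 / g (x (k + 1)) := by
    have : 0 < γlo - L / 2 := by linarith
    positivity
  have := tailSum_eq_add hε k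
  linarith

lemma IsIVPGSA.ratioAt_le (hx : IsIVPGSA f h g ε H x y Δ δ)
    (hA : BasicAssumptions f h g L) {γlo : ℝ} (hγ : L / 2 < γlo)
    (hH : ∀ k, (H k - γlo • (1 : Matrix (Fin n) (Fin n) ℝ)).PosSemidef) (hε : Summable ε)
    (k : ℕ) : ratioAt f h g (x k) ≤ ratioAt f h g (x 0) + tailSum ε 0 := by
  have h1 : ratioAt f h g (x k) + tailSum ε k ≤ ratioAt f h g (x 0) + tailSum ε 0 :=
    hx.ratioAt_add_tailSum_antitone hA hγ hH hε (Nat.zero_le k)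
  linarith [tailSum_nonneg hx.eps_nonneg k]

/-- The iterates stay in a compact part of `dom f ∩ {g ≠ 0}`: at a limit point with `g = 0` the
bound `f + h ≤ α g` would give `f + h ≤ 0`. -/
lemma BasicAssumptions.isCompact_closure_range (hA : BasicAssumptions f h g L)
    (hdom : ∀ k, f (x k) ≠ ⊤ ∧ g (x k) ≠ 0) {α : ℝ} (hα : ∀ k, ratioAt f h g (x k) ≤ α) :
    IsCompact (closure (Set.range x)) ∧
      closure (Set.range x) ⊆ effDom f ∩ {z | g z ≠ 0} := by
  constructor
  · refine ((hA.levelBounded α).subset ?_).isCompact_closure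
    rintro _ ⟨k, rfl⟩
    show fracObj f h g (x k) ≤ (α : EReal)
    rw [fracObj_eq_coe (hdom k).1 (hdom k).2]
    exact EReal.coe_le_coe_iff.2 (hα k)
  · have hcont : Continuous fun z => (z, ((α * g z - h z : ℝ) : EReal)) :=
      continuous_id.prodMk (continuous_coe_real_ereal.comp
        ((hA.g_continuous.const_mul α).sub hA.h_contDiff.continuous))
    have hclosed : IsClosed {z | f z ≤ ((α * g z - h z : ℝ) : EReal)} :=
      hA.f_closed.isClosed_epigraph.preimage hcont
    have hsub : Set.range x ⊆ {z | f z ≤ ((α * g z - h z : ℝ) : EReal)} := by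
      rintro _ ⟨k, rfl⟩
      have hg := hA.g_pos _ (hdom k).1 (hdom k).2
      show f (x k) ≤ _
      rw [← EReal.coe_toReal (hdom k).1 (hA.f_proper.1 _), EReal.coe_le_coe_iff]
      have := hα k
      rw [ratioAt, div_le_iff₀ hg] at this
      linarith
    intro z hz
    have hfz : f z ≤ ((α * g z - h z : ℝ) : EReal) := closure_minimal hsub hclosed hz
    have hftop : f z ≠ ⊤ := ne_top_of_le_ne_top (EReal.coe_ne_top _) hfz
    refine ⟨hftop, fun hgz => ?_⟩
    rw [← EReal.coe_toReal hftop (hA.f_proper.1 _), EReal.coe_le_coe_iff, hgz] at hfz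
    linarith [hA.sum_pos z hftop hgz]

/-- On a compact part of `dom f ∩ {g ≠ 0}` the quotient `(f + h) / g` is Lipschitz. -/
lemma BasicAssumptions.exists_abs_ratioAt_sub_le (hA : BasicAssumptions f h g L)
    (hB : LocallyLipschitzOn (effDom f) fun z => (f z).toReal) {K : Set (RSpace n)}
    (hK : IsCompact K) (hKsub : K ⊆ effDom f ∩ {z | g z ≠ 0}) :
    ∃ C, 0 ≤ C ∧ ∀ u ∈ K, ∀ v ∈ K, |ratioAt f h g u - ratioAt f h g v| ≤ C * ‖u - v‖ := by
  have hpos : ∀ z ∈ K, 0 < g z := fun z hz => hA.g_pos z (hKsub hz).1 (hKsub hz).2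
  obtain ⟨Lf, hLf⟩ := (hB.mono fun z hz => (hKsub hz).1).exists_lipschitzOnWith_of_compact hK
  obtain ⟨Lh, hLh⟩ := (hA.h_contDiff.locallyLipschitz.locallyLipschitzOn
    (s := K)).exists_lipschitzOnWith_of_compact hK
  obtain ⟨Lg, hLg⟩ := (hA.g_convex.locallyLipschitz.locallyLipschitzOn
    (s := K)).exists_lipschitzOnWith_of_compact hK
  have hinv : ContinuousOn (fun z => (g z)⁻¹) K :=
    hA.g_continuous.continuousOn.inv₀ fun z hz => (hpos z hz).ne'
  obtain ⟨m, hm⟩ := hK.exists_bound_of_continuousOn hinv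
  have hratio : ContinuousOn (ratioAt f h g) K :=
    (hLf.continuousOn.add hLh.continuousOn).div hA.g_continuous.continuousOn
      fun z hz => (hpos z hz).ne'
  obtain ⟨R, hR⟩ := hK.exists_bound_of_continuousOn hratio
  have hmm : ∀ z ∈ K, (g z)⁻¹ ≤ max m 0 := fun z hz =>
    (le_abs_self _).trans ((hm z hz).trans (le_max_left _ _))
  have hRR : ∀ z ∈ K, |ratioAt f h g z| ≤ max R 0 := fun z hz =>
    (hR z hz).trans (le_max_left _ _)
  have hm0 : 0 ≤ max m 0 := le_max_right _ _
  have hR0 : 0 ≤ max R 0 := le_max_right _ _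
  refine ⟨max m 0 * (Lf + Lh + max R 0 * Lg), by positivity, fun u hu v hv => ?_⟩
  have h1 := hLf.norm_sub_le hu hv
  have h2 := hLh.norm_sub_le hu hv
  have h3 := hLg.norm_sub_le hu hv
  rw [Real.norm_eq_abs] at h1 h2 h3
  have hgu := hpos u hu
  have hgv := hpos v hv
  have hid : ratioAt f h g u - ratioAt f h g v = (g v)⁻¹ * (((f u).toReal - (f v).toReal)
      + (h u - h v) - ratioAt f h g u * (g u - g v)) := by
    simp only [ratioAt]
    field_simp
    ring
  have h4 : |((f u).toReal - (f v).toReal) + (h u - h v) - ratioAt f h g u * (g u - g v)|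
      ≤ (Lf + Lh + max R 0 * Lg) * ‖u - v‖ := by
    have h5 : |ratioAt f h g u * (g u - g v)| ≤ max R 0 * (Lg * ‖u - v‖) := by
      rw [abs_mul]
      exact mul_le_mul (hRR u hu) h3 (abs_nonneg _) hR0
    have h6 := abs_sub (((f u).toReal - (f v).toReal) + (h u - h v))
      (ratioAt f h g u * (g u - g v))
    have h7 := abs_add_le ((f u).toReal - (f v).toReal) (h u - h v)
    linarith
  rw [hid, abs_mul, abs_of_pos (inv_pos.2 hgv), mul_assoc]
  exact mul_le_mul (hmm v hv) h4 (abs_nonneg _) hm0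

/-- The error sequence of the Kurdyka–Łojasiewicz argument: the residuals `Δ k` contribute
`√(ε k)`, and the derivative of `t ^ τ / τ` at `tailParam` contributes the power of the tail. -/
noncomputable def klError (τ : ℝ) (ε : ℕ → ℝ) (k : ℕ) : ℝ :=
  Real.sqrt (ε k) + tailSum ε k ^ (1 - 1 / τ)

/-- The parameter `t ≥ 0` with `t ^ τ / τ = ∑_{i ≥ k} ε i`. -/
noncomputable def tailParam (τ : ℝ) (ε : ℕ → ℝ) (k : ℕ) : ℝ := (τ * tailSum ε k) ^ (1 / τ)

variable {τ : ℝ}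

lemma klError_nonneg (hε : ∀ k, 0 ≤ ε k) (k : ℕ) : 0 ≤ klError τ ε k :=
  add_nonneg (Real.sqrt_nonneg _) (Real.rpow_nonneg (tailSum_nonneg hε k) _)

lemma tailParam_nonneg (hτ : 1 < τ) (hε : ∀ k, 0 ≤ ε k) (k : ℕ) : 0 ≤ tailParam τ ε k :=
  Real.rpow_nonneg (mul_nonneg (by linarith) (tailSum_nonneg hε k)) _

lemma tailParam_rpow_div (hτ : 1 < τ) (hε : ∀ k, 0 ≤ ε k) (k : ℕ) :
    tailParam τ ε k ^ τ / τ = tailSum ε k := by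
  have hτ0 : 0 < τ := by linarith
  rw [tailParam, ← Real.rpow_mul (mul_nonneg hτ0.le (tailSum_nonneg hε k)),
    one_div_mul_cancel hτ0.ne', Real.rpow_one, mul_div_cancel_left₀ _ hτ0.ne']

lemma tailParam_rpow_sub_one (hτ : 1 < τ) (hε : ∀ k, 0 ≤ ε k) (k : ℕ) :
    tailParam τ ε k ^ (τ - 1) = τ ^ (1 - 1 / τ) * tailSum ε k ^ (1 - 1 / τ) := by
  have hτ0 : 0 < τ := by linarith
  rw [tailParam, ← Real.rpow_mul (mul_nonneg hτ0.le (tailSum_nonneg hε k)),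
    ← Real.mul_rpow hτ0.le (tailSum_nonneg hε k)]
  congr 1
  field_simp

lemma tendsto_tailParam (hτ : 1 < τ) (ε : ℕ → ℝ) :
    Tendsto (tailParam τ ε) atTop (𝓝 0) := by
  have hτ0 : 0 < 1 / τ := one_div_pos.2 (by linarith)
  have := ((tendsto_tailSum ε).const_mul τ).rpow_const (p := 1 / τ) (Or.inr hτ0.le)
  rwa [mul_zero, Real.zero_rpow hτ0.ne'] at this

lemma norm_toLp_prod_le {E : Type*} [NormedAddCommGroup E] (u : E) (t : ℝ) :
    ‖WithLp.toLp 2 (u, t)‖ ≤ ‖u‖ + |t| := by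
  refine le_of_sq_le_sq ?_ (by positivity)
  rw [WithLp.prod_norm_sq_eq_of_L2, WithLp.toLp_fst, WithLp.toLp_snd, Real.norm_eq_abs]
  nlinarith [mul_nonneg (norm_nonneg u) (abs_nonneg t)]

/-- The optimality condition of an inexact step, rewritten at the new iterate, yields a regular
subgradient of the auxiliary function whose norm is of the order of the step and the errors. -/
theorem IsIVPGSA.exists_regSubdiff_norm_le (hx : IsIVPGSA f h g ε H x y Δ δ)
    (hA : BasicAssumptions f h g L)
    (hB : LocallyLipschitzOn (effDom f) fun z => (f z).toReal)
    (hC : ContDiffOn ℝ 1 g {z | g z ≠ 0})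
    (hC' : LocallyLipschitzOn {z | g z ≠ 0} (gradient g))
    {γlo γhi : ℝ} (hγlo : L / 2 < γlo) (hγ : γlo ≤ γhi)
    (hH : ∀ k, (H k - γlo • (1 : Matrix (Fin n) (Fin n) ℝ)).PosSemidef ∧
      (γhi • (1 : Matrix (Fin n) (Fin n) ℝ) - H k).PosSemidef)
    (hτ : 1 < τ) (hε : Summable ε) :
    ∃ C, 0 ≤ C ∧ ∀ k, δ k = 0 →
      ∃ v ∈ regSubdiff (auxFun τ f h g) (WithLp.toLp 2 (x (k + 1), tailParam τ ε (k + 1))),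
        ‖v‖ ≤ C * (‖x (k + 1) - x k‖ + klError τ ε k) := by
  have hγhi : 0 < γhi := by linarith [hA.L_pos]
  set α := ratioAt f h g (x 0) + tailSum ε 0
  have hα := hx.ratioAt_le hA hγlo (fun k => (hH k).1) hε
  have hα0 : 0 ≤ α := (hx.ratioAt_nonneg hA 0).trans (hα 0)
  obtain ⟨hK, hKsub⟩ := hA.isCompact_closure_range hx.mem_domain hα
  set K := closure (Set.range x)
  have hxK : ∀ k, x k ∈ K := fun k => subset_closure ⟨k, rfl⟩
  obtain ⟨Lc, hLc0, hLc⟩ := hA.exists_abs_ratioAt_sub_le hB hK hKsub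
  obtain ⟨Lg, hLg⟩ := (hC'.mono fun z hz => (hKsub hz).2).exists_lipschitzOnWith_of_compact hK
  obtain ⟨G₀, hG₀⟩ := hK.exists_bound_of_continuousOn hLg.continuousOn
  obtain ⟨M₀, hM₀⟩ := hK.exists_bound_of_continuousOn hA.g_continuous.continuousOn
  have hinv : ContinuousOn (fun z => (g z)⁻¹) K :=
    hA.g_continuous.continuousOn.inv₀ fun z hz => (hKsub hz).2
  obtain ⟨m₀, hm₀⟩ := hK.exists_bound_of_continuousOn hinv
  set G := max G₀ 0
  set M := max M₀ 0
  set m := max m₀ 0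
  have hG0 : 0 ≤ G := le_max_right _ _
  have hM0 : 0 ≤ M := le_max_right _ _
  have hm0 : 0 ≤ m := le_max_right _ _
  have hL0 := hA.L_pos.le
  set C₁ := L + γhi + α * Lg + Lc * G with hC₁
  have hC₁0 : 0 ≤ C₁ := by positivity
  set T := τ ^ (1 - 1 / τ) with hT
  have hT0 : 0 ≤ T := Real.rpow_nonneg (by linarith) _
  refine ⟨m * C₁ + m * Real.sqrt M + T, by positivity, fun k hδ => ?_⟩
  obtain ⟨d, hd, hΔ⟩ := hx.inexact k
  rw [hδ] at hd
  have hdom := hx.mem_domain (k + 1)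
  have hdiff : DifferentiableAt ℝ g (x (k + 1)) :=
    differentiableAt_of_contDiffOn_ne_zero hA.g_continuous hC hdom.2
  have hmem := mem_regSubdiff_auxFun hτ hA.f_proper.1 hA.g_pos hdom.1 hdom.2
    (hA.h_contDiff.differentiable one_ne_zero _) hdiff hd
    (tailParam_nonneg hτ hx.eps_nonneg (k + 1))
  refine ⟨_, hmem, (norm_toLp_prod_le _ _).trans ?_⟩
  set s := x (k + 1) - x k with hs
  have hs0 := norm_nonneg s
  have hΔn : ‖Δ k‖ ≤ Real.sqrt M * Real.sqrt (ε k) := by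
    rw [← Real.sqrt_mul hM0]
    refine Real.le_sqrt_of_sq_le ?_
    have h1 := hx.criterion k
    have h2 := abs_nonneg (inner ℝ (Δ k) (x (k + 1) - x k))
    have h3 : g (x (k + 1)) ≤ M := (le_abs_self _).trans ((hM₀ _ (hxK _)).trans (le_max_left _ _))
    have h4 := mul_le_mul_of_nonneg_left h3 (hx.eps_nonneg k)
    rw [hδ] at h1
    linarith
  have hw : d + gradient h (x (k + 1)) - ratioAt f h g (x (k + 1)) • gradient g (x (k + 1)) =
      Δ k + (gradient h (x (k + 1)) - gradient h (x k)) - (H k).toEuclideanLin s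
      + ratioAt f h g (x k) • (gradient g (x k) - gradient g (x (k + 1)))
      + (ratioAt f h g (x k) - ratioAt f h g (x (k + 1))) • gradient g (x (k + 1)) := by
    rw [hΔ, hx.subgrad_eq_gradient hA hC k]
    module
  have hwn : ‖d + gradient h (x (k + 1)) - ratioAt f h g (x (k + 1)) • gradient g (x (k + 1))‖
      ≤ Real.sqrt M * Real.sqrt (ε k) + C₁ * ‖s‖ := by
    have h1 := hA.h_lipschitz (x (k + 1)) (x k)
    have hpos : (H k).PosSemidef := (hx.metric_posDef k).posSemidef
    have h2 := Matrix.norm_toEuclideanLin_le_of_posSemidef hγhi hpos (hH k).2 s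
    have h3 : ‖ratioAt f h g (x k) • (gradient g (x k) - gradient g (x (k + 1)))‖
        ≤ α * (Lg * ‖s‖) := by
      rw [norm_smul, Real.norm_of_nonneg (hx.ratioAt_nonneg hA k), hs, norm_sub_rev (x (k + 1))]
      exact mul_le_mul (hα k) (hLg.norm_sub_le (hxK _) (hxK _)) (norm_nonneg _) hα0
    have h4 : ‖(ratioAt f h g (x k) - ratioAt f h g (x (k + 1))) • gradient g (x (k + 1))‖
        ≤ (Lc * ‖s‖) * G := by
      rw [norm_smul, Real.norm_eq_abs, hs, norm_sub_rev (x (k + 1))]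
      exact mul_le_mul (hLc _ (hxK _) _ (hxK _)) ((hG₀ _ (hxK _)).trans (le_max_left _ _))
        (norm_nonneg _) (by positivity)
    rw [hw]
    refine (norm_add_le _ _).trans ?_
    refine (add_le_add (norm_add_le _ _) le_rfl).trans ?_
    refine (add_le_add (add_le_add (norm_sub_le _ _) le_rfl) le_rfl).trans ?_
    refine (add_le_add (add_le_add (add_le_add (norm_add_le _ _) le_rfl) le_rfl) le_rfl).trans ?_
    rw [hC₁]
    linarith
  have hginv : ‖(g (x (k + 1)))⁻¹‖ ≤ m := (hm₀ _ (hxK _)).trans (le_max_left _ _)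
  rw [norm_smul, tailParam_rpow_sub_one hτ hx.eps_nonneg, ← hT,
    abs_of_nonneg (mul_nonneg hT0 (Real.rpow_nonneg (tailSum_nonneg hx.eps_nonneg _) _))]
  have h1 := mul_le_mul hginv hwn (norm_nonneg _) hm0
  have hexp : 0 ≤ 1 - 1 / τ := by
    rw [sub_nonneg, div_le_one (by linarith)]; exact hτ.le
  have h2 : tailSum ε (k + 1) ^ (1 - 1 / τ) ≤ tailSum ε k ^ (1 - 1 / τ) :=
    Real.rpow_le_rpow (tailSum_nonneg hx.eps_nonneg _)
      (tailSum_antitone hx.eps_nonneg hε (Nat.le_succ k)) hexp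
  have h3 := mul_le_mul_of_nonneg_left h2 hT0
  have h4 : 0 ≤ tailSum ε k ^ (1 - 1 / τ) :=
    Real.rpow_nonneg (tailSum_nonneg hx.eps_nonneg _) _
  have h5 := Real.sqrt_nonneg (ε k)
  have h6 := Real.sqrt_nonneg M
  have e1 : 0 ≤ m * C₁ * Real.sqrt (ε k) := by positivity
  have e2 : 0 ≤ m * C₁ * tailSum ε k ^ (1 - 1 / τ) := by positivity
  have e3 : 0 ≤ m * Real.sqrt M * ‖s‖ := by positivity
  have e4 : 0 ≤ m * Real.sqrt M * tailSum ε k ^ (1 - 1 / τ) := by positivity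
  have e5 : 0 ≤ T * ‖s‖ := by positivity
  have e6 : 0 ≤ T * Real.sqrt (ε k) := by positivity
  rw [klError]
  linarith

/-- The data needed for the Kurdyka–Łojasiewicz argument: a cluster point `xs`, the gap
`φ k = c_k + ∑_{i ≥ k} ε i - lim c`, sufficient decrease, and the Kurdyka–Łojasiewicz inequality
for the auxiliary function read along the iterates. -/
theorem IsIVPGSA.exists_kl_data (hx : IsIVPGSA f h g ε H x y Δ δ)
    (hA : BasicAssumptions f h g L)
    (hB : LocallyLipschitzOn (effDom f) fun z => (f z).toReal)
    (hC : ContDiffOn ℝ 1 g {z | g z ≠ 0})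
    (hC' : LocallyLipschitzOn {z | g z ≠ 0} (gradient g))
    {γlo γhi : ℝ} (hγlo : L / 2 < γlo) (hγ : γlo ≤ γhi)
    (hH : ∀ k, (H k - γlo • (1 : Matrix (Fin n) (Fin n) ℝ)).PosSemidef ∧
      (γhi • (1 : Matrix (Fin n) (Fin n) ℝ) - H k).PosSemidef)
    (hD : ∃ K₀ : ℕ, ∀ k ≥ K₀, δ k = 0)
    (hτ : 1 < τ) (hε : Summable ε) (hes : Summable (klError τ ε)) {θ : ℝ}
    (hKL : IsKLFunctionWithExponent (auxFun τ f h g) θ) :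
    ∃ (xs : RSpace n) (φ : ℕ → ℝ) (b μ C : ℝ), 0 < b ∧ 0 < μ ∧ 0 ≤ C ∧
      MapClusterPt xs atTop x ∧ (∀ k, 0 ≤ φ k) ∧
      (∀ k, φ (k + 1) + b * ‖x (k + 1) - x k‖ ^ 2 ≤ φ k) ∧ Tendsto φ atTop (𝓝 0) ∧
      ∀ᶠ k in atTop, ‖x (k + 1) - xs‖ < μ → 0 < φ (k + 1) →
        φ (k + 1) ^ θ ≤ C * (‖x (k + 1) - x k‖ + klError τ ε k) := by
  obtain ⟨K₀, hK₀⟩ := hD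
  have hH1 := fun k => (hH k).1
  have hτ0 : 0 < τ := by linarith
  obtain ⟨hK, hKsub⟩ := hA.isCompact_closure_range hx.mem_domain (hx.ratioAt_le hA hγlo hH1 hε)
  have hxK : ∀ k, x k ∈ closure (Set.range x) := fun k => subset_closure ⟨k, rfl⟩
  obtain ⟨Lc, hLc0, hLc⟩ := hA.exists_abs_ratioAt_sub_le hB hK hKsub
  obtain ⟨M₀, hM₀⟩ := hK.exists_bound_of_continuousOn hA.g_continuous.continuousOn
  obtain ⟨C, hC0, hsub⟩ := hx.exists_regSubdiff_norm_le hA hB hC hC' hγlo hγ hH hτ hε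
  -- the values converge
  have hanti := hx.ratioAt_add_tailSum_antitone hA hγlo hH1 hε
  obtain ⟨l, hl⟩ : ∃ l, Tendsto (fun k => ratioAt f h g (x k) + tailSum ε k) atTop (𝓝 l) :=
    ⟨_, tendsto_atTop_ciInf hanti ⟨0, by
      rintro _ ⟨k, rfl⟩
      exact add_nonneg (hx.ratioAt_nonneg hA k) (tailSum_nonneg hx.eps_nonneg k)⟩⟩
  have hratio : Tendsto (fun k => ratioAt f h g (x k)) atTop (𝓝 l) := by
    simpa using hl.sub (tendsto_tailSum ε)
  set φ : ℕ → ℝ := fun k => ratioAt f h g (x k) + tailSum ε k - l with hφ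
  have hφ0 : Tendsto φ atTop (𝓝 0) := by simpa using hl.sub_const l
  have hφ_nonneg : ∀ k, 0 ≤ φ k := fun k => sub_nonneg.2 (hanti.le_of_tendsto hl k)
  -- a cluster point, reached along indices with exact subgradients
  obtain ⟨xs, hxs, ψ, hψ, hψlim⟩ := hK.tendsto_subseq fun j => hxK (j + K₀ + 1)
  have hidx : Tendsto (fun j => ψ j + K₀) atTop atTop :=
    tendsto_atTop_mono (fun _ => Nat.le_add_right _ _) hψ.tendsto_atTop
  have hidx' : Tendsto (fun j => ψ j + K₀ + 1) atTop atTop :=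
    tendsto_atTop_mono (fun _ => Nat.le_add_right _ _) hidx
  have hcl : MapClusterPt xs atTop x := MapClusterPt.of_comp hidx' hψlim.mapClusterPt
  have hxsdom := hKsub hxs
  have hl_eq : ratioAt f h g xs = l := by
    refine tendsto_nhds_unique (f := fun j => ratioAt f h g (x (ψ j + K₀ + 1))) ?_
      (hratio.comp hidx')
    rw [tendsto_iff_norm_sub_tendsto_zero]
    refine squeeze_zero (fun _ => norm_nonneg _) (fun j => hLc _ (hxK _) _ hxs) ?_
    simpa using (tendsto_iff_norm_sub_tendsto_zero.1 hψlim).const_mul Lc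
  have hM1 : 0 < max M₀ 1 := lt_max_of_lt_right one_pos
  set b := (γlo - L / 2) / max M₀ 1 with hb
  have hb0 : 0 < b := div_pos (by linarith) hM1
  have hdesc : ∀ k, φ (k + 1) + b * ‖x (k + 1) - x k‖ ^ 2 ≤ φ k := by
    intro k
    have h1 := hx.ratioAt_succ_le hA hH1 k
    have h2 := tailSum_eq_add hε k
    have h3 : b * ‖x (k + 1) - x k‖ ^ 2 ≤
        (γlo - L / 2) * ‖x (k + 1) - x k‖ ^ 2 / g (x (k + 1)) := by
      rw [hb, div_mul_eq_mul_div]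
      have h4 : 0 ≤ (γlo - L / 2) * ‖x (k + 1) - x k‖ ^ 2 :=
        mul_nonneg (by linarith) (sq_nonneg _)
      exact div_le_div_of_nonneg_left h4 (hx.g_pos hA (k + 1))
        ((le_abs_self _).trans ((hM₀ _ (hxK _)).trans (le_max_left _ _)))
    simp only [hφ]
    linarith
  have hsteps := tendsto_step_of_descent hb0 hdesc hφ0
  have hval : ∀ k, auxFun τ f h g (WithLp.toLp 2 (x k, tailParam τ ε k)) =
      ((φ k + l : ℝ) : EReal) := by
    intro k
    rw [auxFun_eq_coe (tailParam_nonneg hτ hx.eps_nonneg k) (hx.mem_domain k).1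
      (hx.mem_domain k).2, tailParam_rpow_div hτ hx.eps_nonneg]
    simp [hφ]
  have hval_s : auxFun τ f h g (WithLp.toLp 2 (xs, (0 : ℝ))) = (l : EReal) := by
    rw [auxFun_eq_coe le_rfl hxsdom.1 hxsdom.2, Real.zero_rpow hτ0.ne', hl_eq]
    simp
  -- the limiting subdifferential at the limit is nonempty: it contains zero
  have hne : (limSubdiff (auxFun τ f h g) (WithLp.toLp 2 (xs, (0 : ℝ)))).Nonempty := by
    choose v hv hvn using fun j => hsub (ψ j + K₀) (hK₀ _ (Nat.le_add_left _ _))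
    refine ⟨0, by rw [hval_s]; exact EReal.coe_ne_top _, by rw [hval_s]; exact EReal.coe_ne_bot _,
      fun j => WithLp.toLp 2 (x (ψ j + K₀ + 1), tailParam τ ε (ψ j + K₀ + 1)), v, ?_, ?_, hv, ?_⟩
    · exact ((WithLp.prod_continuous_toLp 2 _ _).tendsto (xs, (0 : ℝ))).comp
        (hψlim.prodMk_nhds ((tendsto_tailParam hτ ε).comp hidx'))
    · simp only [hval, hval_s]
      refine (continuous_coe_real_ereal.tendsto l).comp ?_
      simpa using (hφ0.comp hidx').add_const l
    · refine squeeze_zero_norm hvn ?_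
      have := ((hsteps.add hes.tendsto_atTop_zero).const_mul C).comp hidx
      simp only [add_zero, mul_zero] at this
      exact this
  obtain ⟨a, ha, μ, hμ, ν, hν, hkl⟩ := hKL _ hne
  refine ⟨xs, φ, b, μ / 2, a⁻¹ * C, hb0, by positivity, by positivity, hcl, hφ_nonneg, hdesc,
    hφ0, ?_⟩
  have ht : ∀ᶠ k in atTop, tailParam τ ε (k + 1) < μ / 2 :=
    ((tendsto_tailParam hτ ε).comp (tendsto_add_atTop_nat 1)).eventually_lt_const (by positivity)
  have hφν : ∀ᶠ k in atTop, φ (k + 1) < ν :=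
    (hφ0.comp (tendsto_add_atTop_nat 1)).eventually_lt_const hν
  filter_upwards [ht, hφν, eventually_ge_atTop K₀] with k hk1 hk2 hk3 hball hpos
  obtain ⟨v, hv, hvn⟩ := hsub k (hK₀ k hk3)
  have hvlim := regSubdiff_subset_limSubdiff _ _ hv
  have h1 := hkl _ ⟨v, hvlim⟩ ?_ ?_ ?_
  · rw [hval, hval_s, EReal.toReal_coe, EReal.toReal_coe, add_sub_cancel_right] at h1
    have h2 := Metric.infDist_le_dist_of_mem (x := 0) hvlim
    rw [dist_zero_left] at h2
    rw [mul_assoc, ← div_eq_inv_mul, le_div_iff₀ ha]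
    linarith
  · rw [← WithLp.toLp_sub, Prod.mk_sub_mk, sub_zero]
    refine (norm_toLp_prod_le _ _).trans ?_
    rw [abs_of_nonneg (tailParam_nonneg hτ hx.eps_nonneg _)]
    linarith
  · rw [hval, hval_s, EReal.coe_lt_coe_iff]
    linarith
  · rw [hval, hval_s, ← EReal.coe_add, EReal.coe_lt_coe_iff]
    linarith

end Algorithm

/-! ### Size of the errors -/

section ErrorRates

variable {τ q ε₀ : ℝ} {ε : ℕ → ℝ}

lemma exists_klError_le_geometric (hτ : 1 < τ) (hε₀ : 0 < ε₀) (hq : 0 < q) (hq1 : q < 1)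
    (hε : ∀ k, ε k = ε₀ * q ^ k) :
    ∃ r B : ℝ, 0 ≤ r ∧ r < 1 ∧ 0 ≤ B ∧ ∀ k, klError τ ε k ≤ B * r ^ k := by
  have hexp : 0 < 1 - 1 / τ := by
    rw [sub_pos, div_lt_one (by linarith)]; exact hτ
  set s := 1 - 1 / τ
  have hεn : ∀ k, 0 ≤ ε k := fun k => by rw [hε]; positivity
  have hq' : 0 < 1 - q := by linarith
  set r := max (q ^ (1 / 2 : ℝ)) (q ^ s)
  have hr0 : 0 ≤ r := le_max_of_le_left (by positivity)
  refine ⟨r, ε₀ ^ (1 / 2 : ℝ) + (ε₀ / (1 - q)) ^ s, hr0,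
    max_lt (Real.rpow_lt_one hq.le hq1 (by norm_num)) (Real.rpow_lt_one hq.le hq1 hexp),
    by positivity, fun k => ?_⟩
  have h1 : Real.sqrt (ε k) ≤ ε₀ ^ (1 / 2 : ℝ) * r ^ k := by
    rw [Real.sqrt_eq_rpow, hε, Real.mul_rpow hε₀.le (by positivity), ← Real.rpow_pow_comm hq.le]
    gcongr
    exact le_max_left _ _
  have h2 : tailSum ε k ^ s ≤ (ε₀ / (1 - q)) ^ s * r ^ k := by
    have h3 := tailSum_le_of_le_geometric hεn hq.le hq1 hε₀.le (fun k => (hε k).le) k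
    calc tailSum ε k ^ s ≤ (ε₀ / (1 - q) * q ^ k) ^ s :=
          Real.rpow_le_rpow (tailSum_nonneg hεn k) h3 hexp.le
      _ = (ε₀ / (1 - q)) ^ s * (q ^ s) ^ k := by
          rw [Real.mul_rpow (by positivity) (by positivity), ← Real.rpow_pow_comm hq.le]
      _ ≤ _ := by gcongr; exact le_max_right _ _
  rw [klError, add_mul]
  exact add_le_add h1 h2

lemma exists_pow_le_rpow_neg {r : ℝ} (hr : 0 ≤ r) (hr1 : r < 1) (p : ℝ) :
    ∃ B : ℝ, 0 ≤ B ∧ ∀ k : ℕ, 1 ≤ k → r ^ k ≤ B * (k : ℝ) ^ (-p) := by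
  obtain ⟨N, hN⟩ := exists_nat_ge p
  have h := tendsto_pow_const_mul_const_pow_of_abs_lt_one N (by rwa [abs_of_nonneg hr])
  obtain ⟨B, hB⟩ := h.bddAbove_range
  refine ⟨max B 0, le_max_right _ _, fun k hk => ?_⟩
  have hk1 : (1 : ℝ) ≤ k := by exact_mod_cast hk
  have hk0 : (0 : ℝ) < k := by linarith
  have h1 : (k : ℝ) ^ N * r ^ k ≤ max B 0 := (hB ⟨k, rfl⟩).trans (le_max_left _ _)
  have h2 : (k : ℝ) ^ p ≤ (k : ℝ) ^ N := by
    rw [← Real.rpow_natCast]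
    exact Real.rpow_le_rpow_of_exponent_le hk1 hN
  rw [Real.rpow_neg hk0.le, ← div_eq_mul_inv, le_div_iff₀ (by positivity), mul_comm]
  exact (mul_le_mul_of_nonneg_right h2 (by positivity)).trans h1

lemma exists_klError_le_rpow (hτ : 1 < τ) (hε₀ : 0 < ε₀) (hq : 1 < q)
    (hε : ∀ k : ℕ, ε k = ε₀ / ((k : ℝ) + 1) ^ q) {p : ℝ} (hp1 : p + 1 ≤ q / 2)
    (hp2 : p + 1 ≤ (τ - 1) / τ * (q - 1)) :
    ∃ B : ℝ, 0 ≤ B ∧ ∀ k : ℕ, 1 ≤ k → klError τ ε k ≤ B * (k : ℝ) ^ (-(p + 1)) := by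
  have hτ0 : 0 < τ := by linarith
  have hexp : 0 < 1 - 1 / τ := by
    rw [sub_pos, div_lt_one hτ0]; exact hτ
  have hs : (τ - 1) / τ = 1 - 1 / τ := by field_simp
  rw [hs] at hp2
  set s := 1 - 1 / τ
  have hεn : ∀ k, 0 ≤ ε k := fun k => by rw [hε]; positivity
  have hεle : ∀ k : ℕ, 1 ≤ k → ε k ≤ ε₀ * (k : ℝ) ^ (-q) := by
    intro k hk
    have hk0 : (0 : ℝ) < k := by exact_mod_cast hk
    rw [hε, Real.rpow_neg hk0.le, ← div_eq_mul_inv]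
    gcongr
    linarith
  have hq1 : 0 < q - 1 := by linarith
  set D := ε₀ * 2 ^ (q - 1 + 1) / (q - 1)
  have hD : 0 ≤ D := by positivity
  refine ⟨ε₀ ^ (1 / 2 : ℝ) + D ^ s, by positivity, fun k hk => ?_⟩
  have hk1 : (1 : ℝ) ≤ k := by exact_mod_cast hk
  have hk0 : (0 : ℝ) < k := by linarith
  have h1 : Real.sqrt (ε k) ≤ ε₀ ^ (1 / 2 : ℝ) * (k : ℝ) ^ (-(p + 1)) := by
    rw [Real.sqrt_eq_rpow]
    calc ε k ^ (1 / 2 : ℝ) ≤ (ε₀ * (k : ℝ) ^ (-q)) ^ (1 / 2 : ℝ) :=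
          Real.rpow_le_rpow (hεn k) (hεle k hk) (by norm_num)
      _ = ε₀ ^ (1 / 2 : ℝ) * (k : ℝ) ^ (-q * (1 / 2)) := by
          rw [Real.mul_rpow hε₀.le (by positivity), ← Real.rpow_mul hk0.le]
      _ ≤ _ := by
          refine mul_le_mul_of_nonneg_left
            (Real.rpow_le_rpow_of_exponent_le hk1 ?_) (by positivity)
          linarith
  have h2 : tailSum ε k ^ s ≤ D ^ s * (k : ℝ) ^ (-(p + 1)) := by
    have h3 := tailSum_le_of_le_rpow hεn hq1 hε₀.le
      (fun k hk => by simpa using hεle k hk) hk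
    calc tailSum ε k ^ s ≤ (D * (k : ℝ) ^ (-(q - 1))) ^ s :=
          Real.rpow_le_rpow (tailSum_nonneg hεn k) h3 hexp.le
      _ = D ^ s * (k : ℝ) ^ (-(q - 1) * s) := by
          rw [Real.mul_rpow hD (by positivity), ← Real.rpow_mul hk0.le]
      _ ≤ _ := by
          refine mul_le_mul_of_nonneg_left
            (Real.rpow_le_rpow_of_exponent_le hk1 ?_) (by positivity)
          linarith
  rw [klError, add_mul]
  exact add_le_add h1 h2

end ErrorRates

/-! ### Comparison of the exponents -/

section Exponents

variable {τ q θ : ℝ}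

lemma one_lt_mul_sub_one_of_lt (hτ : 1 < τ) (hq : (2 * τ - 1) / (τ - 1) < q) :
    1 < (τ - 1) / τ * (q - 1) := by
  rw [div_lt_iff₀ (by linarith)] at hq
  rw [div_mul_eq_mul_div, lt_div_iff₀ (by linarith)]
  linarith

lemma two_lt_of_lt (hτ : 1 < τ) (hq : (2 * τ - 1) / (τ - 1) < q) : 2 < q := by
  refine lt_of_le_of_lt ?_ hq
  rw [le_div_iff₀ (by linarith)]
  linarith

lemma mul_sub_one_le_half (hτ : 1 < τ) (hq : 0 < q)
    (h : τ ≤ 2 ∨ (2 < τ ∧ q < 2 * (τ - 1) / (τ - 2))) :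
    (τ - 1) / τ * (q - 1) ≤ q / 2 := by
  rw [div_mul_eq_mul_div, div_le_div_iff₀ (by linarith) two_pos]
  rcases h with h | ⟨h, h'⟩
  · nlinarith [mul_nonneg hq.le (sub_nonneg.2 h)]
  · rw [lt_div_iff₀ (by linarith)] at h'
    linarith

lemma half_le_mul_sub_one (hτ : 2 < τ) (h : 2 * (τ - 1) / (τ - 2) ≤ q) :
    q / 2 ≤ (τ - 1) / τ * (q - 1) := by
  rw [div_le_iff₀ (by linarith)] at h
  rw [div_mul_eq_mul_div, div_le_div_iff₀ two_pos (by linarith)]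
  linarith

lemma div_two_mul_sub_one_sub_one (hθ : 1 / 2 < θ) :
    θ / (2 * θ - 1) - 1 = (1 - θ) / (2 * θ - 1) := by
  have : 2 * θ - 1 ≠ 0 := by linarith
  rw [div_sub_one this]
  congr 1
  ring

lemma mul_sub_one_lt_iff (hτ : 1 < τ) (c : ℝ) :
    q < τ / (τ - 1) * c + 1 ↔ (τ - 1) / τ * (q - 1) < c := by
  have h1 : 0 < τ - 1 := by linarith
  rw [← sub_lt_iff_lt_add, div_mul_eq_mul_div, lt_div_iff₀ h1, div_mul_eq_mul_div,
    div_lt_iff₀ (by linarith), mul_comm (q - 1), mul_comm c]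

end Exponents

/-! ### Convergence and rates for the iterates -/

section Rates

variable {n : ℕ} {f : RSpace n → EReal} {h g : RSpace n → ℝ} {L : ℝ}
  {ε : ℕ → ℝ} {H : ℕ → Matrix (Fin n) (Fin n) ℝ} {x y Δ : ℕ → RSpace n} {δ : ℕ → ℝ} {τ θ : ℝ}

/-- The iterates converge; either they are eventually constant, or `θ > 0` and the distance to
the limit has a majorant obeying the recursion. -/
theorem IsIVPGSA.exists_tendsto_and_recursion (hx : IsIVPGSA f h g ε H x y Δ δ)
    (hA : BasicAssumptions f h g L)
    (hB : LocallyLipschitzOn (effDom f) fun z => (f z).toReal)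
    (hC : ContDiffOn ℝ 1 g {z | g z ≠ 0})
    (hC' : LocallyLipschitzOn {z | g z ≠ 0} (gradient g))
    {γlo γhi : ℝ} (hγlo : L / 2 < γlo) (hγ : γlo ≤ γhi)
    (hH : ∀ k, (H k - γlo • (1 : Matrix (Fin n) (Fin n) ℝ)).PosSemidef ∧
      (γhi • (1 : Matrix (Fin n) (Fin n) ℝ) - H k).PosSemidef)
    (hD : ∃ K₀ : ℕ, ∀ k ≥ K₀, δ k = 0)
    (hτ : 1 < τ) (hε : Summable ε) (hes : Summable (klError τ ε))
    (hθ₀ : 0 ≤ θ) (hθ₁ : θ < 1) (hKL : IsKLFunctionWithExponent (auxFun τ f h g) θ) :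
    ∃ xs : RSpace n, Tendsto x atTop (𝓝 xs) ∧ ((∃ K : ℕ, ∀ k ≥ K, x k = xs) ∨
      (0 < θ ∧ ∃ (W : ℕ → ℝ) (C : ℝ), 0 ≤ C ∧ (∀ k, 0 ≤ W k) ∧ Tendsto W atTop (𝓝 0) ∧
        KLRecursion W (klError τ ε) ((1 - θ) / θ) C ∧ ∀ᶠ k in atTop, ‖x k - xs‖ ≤ W k)) := by
  obtain ⟨xs, φ, b, μ, C, hb, hμ, hC0, hcl, hφ, hdesc, hφ0, hkl⟩ :=
    hx.exists_kl_data hA hB hC hC' hγlo hγ hH hD hτ hε hes hKL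
  have he := klError_nonneg (τ := τ) hx.eps_nonneg
  by_cases hzero : ∃ K, φ K = 0
  · obtain ⟨K, hK⟩ := hzero
    have hφanti : Antitone φ := antitone_nat_of_succ_le fun k => by
      have : 0 ≤ b * ‖x (k + 1) - x k‖ ^ 2 := by positivity
      linarith [hdesc k]
    have hconst : ∀ k ≥ K, x k = x K := by
      intro k hk
      induction k, hk using Nat.le_induction with
      | base => rfl
      | succ k hk ih =>
        have h1 : b * ‖x (k + 1) - x k‖ ^ 2 ≤ 0 := by
          linarith [hdesc k, hφ (k + 1), hφanti hk]
        have h2 : ‖x (k + 1) - x k‖ ^ 2 ≤ 0 := nonpos_of_mul_nonpos_right h1 hb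
        have h3 : ‖x (k + 1) - x k‖ = 0 := pow_eq_zero_iff two_ne_zero |>.1
          (le_antisymm h2 (sq_nonneg _))
        rw [← ih, ← sub_eq_zero, ← norm_eq_zero, h3]
    have hlim : Tendsto x atTop (𝓝 (x K)) :=
      tendsto_const_nhds.congr' (eventually_atTop.2 ⟨K, fun k hk => (hconst k hk).symm⟩)
    exact ⟨x K, hlim, Or.inl ⟨K, hconst⟩⟩
  · have hpos : ∀ k, 0 < φ k := fun k =>
      lt_of_le_of_ne (hφ k) fun h0 => hzero ⟨k, h0.symm⟩
    have hkl' : ∀ᶠ k in atTop, ‖x (k + 1) - xs‖ < μ →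
        φ (k + 1) ^ θ ≤ C * (‖x (k + 1) - x k‖ + klError τ ε k) :=
      hkl.mono fun k hk hball => hk hball (hpos _)
    obtain ⟨hlim, c, hc, hW0, hW⟩ :=
      tendsto_of_kl hb hθ₀ hθ₁ hμ hC0 hφ hdesc hφ0 he hes hcl hkl'
    have hball : ∀ᶠ k in atTop, ‖x (k + 1) - xs‖ < μ := by
      have := (hlim.comp (tendsto_add_atTop_nat 1)).eventually (Metric.ball_mem_nhds xs hμ)
      simpa only [Metric.mem_ball, dist_eq_norm, Function.comp_def] using this
    have hkl'' : ∀ᶠ k in atTop,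
        φ (k + 1) ^ θ ≤ C * (‖x (k + 1) - x k‖ + klError τ ε k) :=
      hball.mp (hkl'.mono fun k hk hb => hk hb)
    refine ⟨xs, hlim, Or.inr ?_⟩
    rcases hθ₀.eq_or_lt with h0 | hθpos
    · -- for `θ = 0` the left side is `1`, while the right side tends to zero
      exfalso
      have hrhs : Tendsto (fun k => C * (‖x (k + 1) - x k‖ + klError τ ε k)) atTop (𝓝 0) := by
        simpa using ((tendsto_step_of_descent hb hdesc hφ0).add
          hes.tendsto_atTop_zero).const_mul C
      obtain ⟨k, hk1, hk2⟩ := (hkl''.and (hrhs.eventually_lt_const one_pos)).exists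
      rw [← h0, Real.rpow_zero] at hk1
      linarith
    · obtain ⟨C', hC'0, hrec⟩ := klRecursion_klMajorant hθpos hθ₁ hC0 hc hφ he
        (hW.mono fun k hk => hk.2) hkl''
      exact ⟨hθpos, _, C', hC'0, klMajorant_nonneg hφ he hc, hW0, hrec, hW.mono fun k hk => hk.1⟩

end Rates

theorem theorem4p2 {n : ℕ}
    (f : RSpace n → EReal) (h g : RSpace n → ℝ) (L : ℝ)
    (hA : BasicAssumptions f h g L)
    (hB : LocallyLipschitzOn (effDom f) (fun x => (f x).toReal))
    (hC : ContDiffOn ℝ 1 g {x | g x ≠ 0})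
    (hC' : LocallyLipschitzOn {x | g x ≠ 0} (gradient g))
    (ε : ℕ → ℝ) (H : ℕ → Matrix (Fin n) (Fin n) ℝ)
    (γlo γhi : ℝ) (hγlo : L / 2 < γlo) (hγ : γlo ≤ γhi)
    (hH : ∀ k, (H k - γlo • (1 : Matrix (Fin n) (Fin n) ℝ)).PosSemidef ∧
      (γhi • (1 : Matrix (Fin n) (Fin n) ℝ) - H k).PosSemidef)
    (x y Δ : ℕ → RSpace n) (δ : ℕ → ℝ)
    (hx : IsIVPGSA f h g ε H x y Δ δ)
    (hD : ∃ K₀ : ℕ, ∀ k ≥ K₀, δ k = 0)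
    (τ : ℝ) (hτ : 1 < τ)
    (hε₁ : Summable ε)
    (hε₂ : Summable (fun k => Real.sqrt (ε k)))
    (hε₃ : Summable (fun k => (∑' i, ε (k + i)) ^ (1 - 1 / τ)))
    (θ : ℝ) (hθ₀ : 0 ≤ θ) (hθ₁ : θ < 1)
    (hKL : IsKLFunctionWithExponent (auxFun τ f h g) θ) :
    ∃ xs : RSpace n, Tendsto x atTop (𝓝 xs) ∧
      -- exponent zero: finite convergence
      (θ = 0 → ∃ K : ℕ, ∀ k ≥ K, x k = xs) ∧
      -- exponent in (0, 1/2]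
      (0 < θ → θ ≤ 1 / 2 →
        -- geometric tolerances
        (∀ ε₀ q : ℝ, 0 < ε₀ → 0 < q → q < 1 → (∀ k, ε k = ε₀ * q ^ k) →
          ∃ ρ : ℝ, 0 < ρ ∧ ρ < 1 ∧
            (fun k : ℕ => ‖x k - xs‖) =O[atTop] (fun k : ℕ => ρ ^ k)) ∧
        -- polynomial tolerances
        (∀ ε₀ q : ℝ, 0 < ε₀ → (2 * τ - 1) / (τ - 1) < q →
          (∀ k : ℕ, ε k = ε₀ / ((k : ℝ) + 1) ^ q) →
          (τ ≤ 2 →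
            (fun k : ℕ => ‖x k - xs‖) =O[atTop]
              (fun k : ℕ => (k : ℝ) ^ (-((τ - 1) / τ * (q - 1) - 1)))) ∧
          (2 < τ → q < 2 * (τ - 1) / (τ - 2) →
            (fun k : ℕ => ‖x k - xs‖) =O[atTop]
              (fun k : ℕ => (k : ℝ) ^ (-((τ - 1) / τ * (q - 1) - 1)))) ∧
          (2 < τ → 2 * (τ - 1) / (τ - 2) ≤ q →
            (fun k : ℕ => ‖x k - xs‖) =O[atTop]
              (fun k : ℕ => (k : ℝ) ^ (-(q / 2 - 1)))))) ∧
      -- exponent in (1/2, 1)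
      (1 / 2 < θ →
        -- geometric tolerances
        (∀ ε₀ q : ℝ, 0 < ε₀ → 0 < q → q < 1 → (∀ k, ε k = ε₀ * q ^ k) →
          (fun k : ℕ => ‖x k - xs‖) =O[atTop]
            (fun k : ℕ => (k : ℝ) ^ (-((1 - θ) / (2 * θ - 1))))) ∧
        -- polynomial tolerances
        (∀ ε₀ q : ℝ, 0 < ε₀ → (2 * τ - 1) / (τ - 1) < q →
          (∀ k : ℕ, ε k = ε₀ / ((k : ℝ) + 1) ^ q) →
          -- regime driven by the tail sums of the tolerances
          ((τ ≤ 2 ∨ (2 < τ ∧ q < 2 * (τ - 1) / (τ - 2))) →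
            (q < τ / (τ - 1) * (θ / (2 * θ - 1)) + 1 →
              (fun k : ℕ => ‖x k - xs‖) =O[atTop]
                (fun k : ℕ => (k : ℝ) ^ (-((τ - 1) / τ * (q - 1) - 1)))) ∧
            (τ / (τ - 1) * (θ / (2 * θ - 1)) + 1 ≤ q →
              (fun k : ℕ => ‖x k - xs‖) =O[atTop]
                (fun k : ℕ => (k : ℝ) ^ (-((1 - θ) / (2 * θ - 1)))))) ∧
          -- regime driven by the square roots of the tolerances
          ((2 < τ ∧ 2 * (τ - 1) / (τ - 2) ≤ q) →
            (q < 2 * θ / (2 * θ - 1) →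
              (fun k : ℕ => ‖x k - xs‖) =O[atTop]
                (fun k : ℕ => (k : ℝ) ^ (-(q / 2 - 1)))) ∧
            (2 * θ / (2 * θ - 1) ≤ q →
              (fun k : ℕ => ‖x k - xs‖) =O[atTop]
                (fun k : ℕ => (k : ℝ) ^ (-((1 - θ) / (2 * θ - 1)))))))) := by
  have hes : Summable (klError τ ε) := hε₂.add hε₃
  have he := klError_nonneg (τ := τ) hx.eps_nonneg
  obtain ⟨xs, hlim, halt⟩ := hx.exists_tendsto_and_recursion hA hB hC hC' hγlo hγ hH hD hτ hε₁
    hes hθ₀ hθ₁ hKL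
  refine ⟨xs, hlim, ?_⟩
  rcases halt with ⟨K, hK⟩ | ⟨hθpos, W, C, hC0, hW, hW0, hrec, hdist⟩
  · -- an eventually constant sequence satisfies every rate
    have hO : ∀ F : ℕ → ℝ, (fun k : ℕ => ‖x k - xs‖) =O[atTop] F := fun F =>
      (isBigO_zero F atTop).congr' (eventually_atTop.2 ⟨K, fun k hk => by simp [hK k hk]⟩)
        EventuallyEq.rfl
    exact ⟨fun _ => ⟨K, hK⟩,
      fun _ _ => ⟨fun _ _ _ _ _ _ => ⟨1 / 2, by norm_num, by norm_num, hO _⟩,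
        fun _ _ _ _ _ => ⟨fun _ => hO _, fun _ _ => hO _, fun _ _ => hO _⟩⟩,
      fun _ => ⟨fun _ _ _ _ _ _ => hO _,
        fun _ _ _ _ _ => ⟨fun _ => ⟨fun _ => hO _, fun _ => hO _⟩,
          fun _ => ⟨fun _ => hO _, fun _ => hO _⟩⟩⟩⟩
  have hO : (fun k : ℕ => ‖x k - xs‖) =O[atTop] W :=
    IsBigO.of_bound 1 (hdist.mono fun k hk => by
      rw [norm_norm, Real.norm_of_nonneg (hW k), one_mul]; exact hk)
  refine ⟨fun h0 => absurd h0 hθpos.ne', fun _ hθ2 => ?_, fun hθ2 => ?_⟩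
  · have hα : 1 ≤ (1 - θ) / θ := by
      rw [le_div_iff₀ hθpos]; linarith
    refine ⟨fun ε₀ q hε₀ hq hq1 hε => ?_, fun ε₀ q hε₀ hq hε => ?_⟩
    · obtain ⟨r, B, hr, hr1, hB0, hbound⟩ := exists_klError_le_geometric hτ hε₀ hq hq1 hε
      obtain ⟨σ, hσ, hσ1, hWσ⟩ := hrec.isBigO_geometric hα hC0 hW hW0 he hes hr hr1 hB0 hbound
      exact ⟨σ, hσ, hσ1, hO.trans hWσ⟩
    · have hp := one_lt_mul_sub_one_of_lt hτ hq
      have hq2 := two_lt_of_lt hτ hq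
      have key : ∀ p, 0 < p → p + 1 ≤ q / 2 → p + 1 ≤ (τ - 1) / τ * (q - 1) →
          (fun k : ℕ => ‖x k - xs‖) =O[atTop] fun k : ℕ => (k : ℝ) ^ (-p) := by
        intro p hp0 hp1 hp2
        obtain ⟨B, hB0, hbound⟩ := exists_klError_le_rpow hτ hε₀ (by linarith) hε hp1 hp2
        exact hO.trans (hrec.isBigO_rpow hα hC0 hW hW0 he hes hp0 hB0 hbound)
      refine ⟨fun h => ?_, fun h h' => ?_, fun h h' => ?_⟩
      · have := mul_sub_one_le_half (q := q) hτ (by linarith) (Or.inl h)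
        exact key _ (by linarith) (by linarith) (by linarith)
      · have := mul_sub_one_le_half (q := q) hτ (by linarith) (Or.inr ⟨h, h'⟩)
        exact key _ (by linarith) (by linarith) (by linarith)
      · have := half_le_mul_sub_one h h'
        exact key _ (by linarith) (by linarith) (by linarith)
  · have hα0 : 0 < (1 - θ) / θ := div_pos (by linarith) hθpos
    have hα1 : (1 - θ) / θ < 1 := by rw [div_lt_one hθpos]; linarith
    have h2θ : 0 < 2 * θ - 1 := by linarith
    have hκ : (1 - θ) / θ / (1 - (1 - θ) / θ) = (1 - θ) / (2 * θ - 1) := by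
      rw [one_sub_div hθpos.ne', div_div_div_cancel_right₀ hθpos.ne']
      congr 1
      ring
    have hκ0 : 0 < (1 - θ) / (2 * θ - 1) := div_pos (by linarith) h2θ
    refine ⟨fun ε₀ q hε₀ hq hq1 hε => ?_, fun ε₀ q hε₀ hq hε => ?_⟩
    · obtain ⟨r, B, hr, hr1, hB0, hbound⟩ := exists_klError_le_geometric hτ hε₀ hq hq1 hε
      obtain ⟨B', hB'0, hpow⟩ := exists_pow_le_rpow_neg hr hr1 ((1 - θ) / (2 * θ - 1) + 1)
      refine hO.trans (hrec.isBigO_rpow_of_lt_one (B := B * B') hα0 hα1 hC0 hW hW0 he hes hκ0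
        hκ.ge (by positivity) fun k hk => (hbound k).trans ?_)
      rw [mul_assoc]
      exact mul_le_mul_of_nonneg_left (hpow k hk) hB0
    · have hp := one_lt_mul_sub_one_of_lt hτ hq
      have hq2 := two_lt_of_lt hτ hq
      have key : ∀ p, 0 < p → p ≤ (1 - θ) / (2 * θ - 1) → p + 1 ≤ q / 2 →
          p + 1 ≤ (τ - 1) / τ * (q - 1) →
          (fun k : ℕ => ‖x k - xs‖) =O[atTop] fun k : ℕ => (k : ℝ) ^ (-p) := by
        intro p hp0 hpκ hp1 hp2
        obtain ⟨B, hB0, hbound⟩ := exists_klError_le_rpow hτ hε₀ (by linarith) hε hp1 hp2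
        exact hO.trans (hrec.isBigO_rpow_of_lt_one hα0 hα1 hC0 hW hW0 he hes hp0
          (hpκ.trans hκ.ge) hB0 hbound)
      have hκ1 := div_two_mul_sub_one_sub_one hθ2
      refine ⟨fun h => ?_, fun h => ?_⟩
      · have := mul_sub_one_le_half (q := q) hτ (by linarith) h
        refine ⟨fun h' => ?_, fun h' => ?_⟩
        · rw [mul_sub_one_lt_iff hτ] at h'
          exact key _ (by linarith) (by linarith) (by linarith) (by linarith)
        · rw [← not_lt, mul_sub_one_lt_iff hτ, not_lt] at h'
          exact key _ hκ0 le_rfl (by linarith) (by linarith)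
      · have := half_le_mul_sub_one h.1 h.2
        rw [mul_div_assoc 2 θ]
        refine ⟨fun h' => ?_, fun h' => ?_⟩
        · exact key _ (by linarith) (by linarith) (by linarith) (by linarith)
        · exact key _ hκ0 le_rfl (by linarith) (by linarith)
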